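/- Notation. For $0\le k\le 1$ let $F(\varphi,k)=\int_0^\varphi \frac{d\theta}{\sqrt{1-k^2\sin^2\theta}}$, $E(\varphi,k)=\int_0^\varphi\sqrt{1-k^2\sin^2\theta}\,d\theta$ and $\Pi(\varphi,n,k)=\int_0^\varphi\frac{d\theta}{(1-n\sin^2\theta)\sqrt{1-k^2\sin^2\theta}}$. Let $\operatorname{am}(\cdot,k)$ be the inverse function of $F(\cdot,k)$ (of its restriction to $(-\pi/2,\pi/2)$ if $k=1$), and $\operatorname{sn}=\sin\operatorname{am}$, $\operatorname{cn}=\cos\operatorname{am}$, $\operatorname{dn}=\sqrt{1-k^2\operatorname{sn}^2}$. For real numbers $H\ne0$ and $0\le a\le 1\le b$ put $$c_1=\sqrt{(1-a^2)(b^2-1)},\qquad c_2=a^2+b^2-1,\qquad g(u)=\frac{c_1}{b}\,\Pi\!\left(\operatorname{am}(bu,\tfrac ab),a^2,\tfrac ab\right),$$ and let $\mathbf x=\mathbf x_{H,a,b}\colon\mathbb R^2\to\mathbb C\times\mathbb R\cong\mathbb R^3$ be the helicoid $$-2H\,\mathbf x(u,v)=\begin{pmatrix} e^{i(v+g(u))}\left\{\sqrt{1-a^2\operatorname{sn}^2}+\dfrac{a(b\operatorname{cn}\operatorname{dn}-i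 c_1\operatorname{sn})}{\sqrt{1-a^2\operatorname{sn}^2}}\right\}\\[2mm] -a\operatorname{sn}+(b^2-1)u-bE\!\left(\operatorname{am}(bu,\tfrac ab),\tfrac ab\right)+c_1v\end{pmatrix},$$ where $\operatorname{sn},\operatorname{cn},\operatorname{dn}$ are evaluated at $(bu,\frac ab)$. For $a=1$ (where $c_1=0$), $g$ is read as $0$, $\sqrt{1-a^2\operatorname{sn}^2}$ is read as $\operatorname{cn}$, and the brace is $\operatorname{cn}+b\operatorname{dn}$. Let $\mathbf n=\mathbf x_u\times\mathbf x_v/|\mathbf x_u\times\mathbf x_v|$ be the Gauss map, and put $\mathrm I=\langle d\mathbf x,d\mathbf x\rangle$, $\mathrm{II}=-\langle d\mathbf x,d\mathbf n\rangle$, $\mathrm{III}=\langle d\mathbf n,d\mathbf n\rangle$. The Hopf differential, in isothermal coordinates $(u,v)$, is $Q=\frac12(L-N-2iM)(du+i\,dv)^2$, where $\mathrm{II}=L\,du^2+2M\,du\,dv+N\,dv^2$. The cgc-companion of a surface $\mathbf y$ of non-zero constant mean curvature $h$ with Gauss map $\mathbf n$ is $\check{\mathbf y}=\mathbf y+\frac1{2h}\mathbf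 n$. **Proposition.** (i) $\mathbf x$, $\mathbf n$ and the cgc-companion of $-2H\mathbf x$ are smooth, $\mathbf x$ has constant mean curvature $H$, and $$\begin{aligned}4H^2\,\mathrm I&=(a\operatorname{cn}+b\operatorname{dn})^2(du^2+dv^2),\\ 4H(\mathrm{II}-H\,\mathrm I)&=(c_2-1)(du^2-dv^2)+4c_1\,du\,dv,\\ \mathrm{III}&=(c_2-a^2\operatorname{sn}^2)du^2+2c_1\,du\,dv+(1-a^2\operatorname{sn}^2)dv^2,\\ Q&=\frac{\left(\sqrt{b^2-1}-i\sqrt{1-a^2}\right)^2}{4H}(du+i\,dv)^2.\end{aligned}$$ For the cgc-companion $\check{\mathbf x}$ of $-2H\mathbf x$, the first fundamental form $\check{\mathrm I}=\langle d\check{\mathbf x},d\check{\mathbf x}\rangle$ and the second fundamental form $\check{\mathrm{II}}=-\langle d\check{\mathbf x},d\mathbf n\rangle$ are $$\check{\mathrm I}=(1-a^2\operatorname{sn}^2)du^2-2c_1\,du\,dv+(c_2-a^2\operatorname{sn}^2)dv^2,\qquad \check{\mathrm{II}}=-ab\operatorname{cn}\operatorname{dn}\,(du^2+dv^2).$$ (ii)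 Let $H\neq0$, $0\le a\le1\le b$, $0\le a'\le1\le b'$, $\mathbf x=\mathbf x_{H,a,b}$ and $\mathbf x'=\mathbf x_{H,a',b'}$. The following are equivalent: 1. $a/b=a'/b'$. 2. $\mathbf x$ and $\mathbf x'$ belong to the same associated family: there are an orientation-preserving diffeomorphism $\varphi$ of $\mathbb R^2$ and $\theta\in\mathbb R$ such that $\varphi$ carries $\mathrm I'$ and the mean curvature of $\mathbf x'$ back to those of $\mathbf x$, and $\varphi^*Q'=e^{i\theta}Q$. 3. $\mathbf x$ and $\mathbf x'$ are isometric: there is a diffeomorphism $\varphi$ of $\mathbb R^2$ with $\varphi^*\mathrm I'=\mathrm I$. 4. $\mathbf x$ and $\mathbf x'$ are locally isometric: there are a non-empty open set $U\subseteq\mathbb R^2$ and a smooth map $\varphi\colon U\to\mathbb R^2$ with $\varphi^*\mathrm I'=\mathrm I$ on $U$. -/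

import Mathlib

open scoped ContDiff

noncomputable section

/-! Elliptic integrals and Jacobi's elliptic functions of modulus `k`, `0 ≤ k ≤ 1`. -/

/-- Elliptic integral of the first kind. -/
def ellipticF (φ k : ℝ) : ℝ :=
  ∫ θ in (0 : ℝ)..φ, 1 / √(1 - k ^ 2 * Real.sin θ ^ 2)

/-- Elliptic integral of the second kind. -/
def ellipticE (φ k : ℝ) : ℝ :=
  ∫ θ in (0 : ℝ)..φ, √(1 - k ^ 2 * Real.sin θ ^ 2)

/-- Elliptic integral of the third kind. -/
def ellipticPi (φ n k : ℝ) : ℝ :=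
  ∫ θ in (0 : ℝ)..φ,
    1 / ((1 - n * Real.sin θ ^ 2) * √(1 - k ^ 2 * Real.sin θ ^ 2))

/-- The interval around `0` on which the integrand of `ellipticF` is regular:
all of `ℝ` if `0 ≤ k < 1`, and `(-π/2, π/2)` if `k = 1`. -/
def ellipticDomain (k : ℝ) : Set ℝ :=
  {φ | ∀ θ ∈ Set.uIcc 0 φ, k ^ 2 * Real.sin θ ^ 2 < 1}

/-- Jacobi's amplitude: the inverse function of `φ ↦ F(φ, k)`. -/
def jacobiAm (u k : ℝ) : ℝ :=
  Function.invFunOn (fun φ => ellipticF φ k) (ellipticDomain k) u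

def jacobiSn (u k : ℝ) : ℝ := Real.sin (jacobiAm u k)

def jacobiCn (u k : ℝ) : ℝ := Real.cos (jacobiAm u k)

def jacobiDn (u k : ℝ) : ℝ := √(1 - k ^ 2 * jacobiSn u k ^ 2)

/-! Parametrized surfaces in Euclidean 3-space. -/

abbrev E3 : Type := EuclideanSpace ℝ (Fin 3)

/-- A map from the `(u, v)`-plane to `E3`; a tangent vector `w` has `du w = w.1`, `dv w = w.2`. -/
abbrev ParamSurface : Type := ℝ × ℝ → E3

/-- The identification of `ℂ × ℝ` with `E3`. -/
def toE3 (X : ℂ) (z : ℝ) : E3 := !₂[X.re, X.im, z]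

def crossE3 (x y : E3) : E3 := WithLp.toLp 2 (crossProduct x.ofLp y.ofLp)

/-- The Gauss map `x_u × x_v / |x_u × x_v|`. -/
def gaussMap (x : ParamSurface) : ParamSurface := fun p =>
  let c := crossE3 (fderiv ℝ x p (1, 0)) (fderiv ℝ x p (0, 1))
  ‖c‖⁻¹ • c

/-- The first fundamental form `⟨dx, dx⟩`, as a bilinear form. -/
def firstForm (x : ParamSurface) (p w w' : ℝ × ℝ) : ℝ :=
  inner ℝ (fderiv ℝ x p w) (fderiv ℝ x p w')

/-- The second fundamental form `-⟨dx, dn⟩` of `x` with respect to the unit normal field `n`. -/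
def secondForm (x n : ParamSurface) (p w w' : ℝ × ℝ) : ℝ :=
  -inner ℝ (fderiv ℝ x p w) (fderiv ℝ n p w')

/-- The third fundamental form `⟨dn, dn⟩`. -/
def thirdForm (n : ParamSurface) (p w w' : ℝ × ℝ) : ℝ :=
  inner ℝ (fderiv ℝ n p w) (fderiv ℝ n p w')

/-- Mean curvature of an immersion: half the trace of the second fundamental form
(with respect to the Gauss map) relative to the first. -/
def meanCurvature (x : ParamSurface) (p : ℝ × ℝ) : ℝ :=
  let E := firstForm x p (1, 0) (1, 0)
  let F := firstForm x p (1, 0) (0, 1)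
  let G := firstForm x p (0, 1) (0, 1)
  let L := secondForm x (gaussMap x) p (1, 0) (1, 0)
  let M := secondForm x (gaussMap x) p (1, 0) (0, 1)
  let N := secondForm x (gaussMap x) p (0, 1) (0, 1)
  (E * N - 2 * F * M + G * L) / (2 * (E * G - F ^ 2))

/-- The Hopf differential `Q = ½ (L - N - 2 i M) (du + i dv)²` of an immersion in isothermal
coordinates `(u, v)`; it is the `(2,0)`-form with `Re Q = II - H I`. -/
def hopfDifferential (x : ParamSurface) (p w : ℝ × ℝ) : ℂ :=
  let L := secondForm x (gaussMap x) p (1, 0) (1, 0)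
  let M := secondForm x (gaussMap x) p (1, 0) (0, 1)
  let N := secondForm x (gaussMap x) p (0, 1) (0, 1)
  (((L - N) / 2 : ℝ) - Complex.I * (M : ℝ)) * ((w.1 : ℂ) + Complex.I * (w.2 : ℂ)) ^ 2

/-- The parallel surface `x + n / (2 H)`; it is the cgc-companion of `x` if `x` has non-zero
constant mean curvature. -/
def cgcCompanion (x : ParamSurface) : ParamSurface := fun p =>
  x p + (1 / (2 * meanCurvature x p)) • gaussMap x p

/-- `φ` is an isometry of the induced metrics from the set `U` into the domain of `x'`. -/
def PullsBackMetricOn (x x' : ParamSurface) (φ : ℝ × ℝ → ℝ × ℝ) (U : Set (ℝ × ℝ)) : Prop :=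
  ∀ p ∈ U, ∀ w : ℝ × ℝ,
    firstForm x' (φ p) (fderiv ℝ φ p w) (fderiv ℝ φ p w) = firstForm x p w w

/-- The induced metrics are isometric by a diffeomorphism of the plane. -/
def IsometricSurfaces (x x' : ParamSurface) : Prop :=
  ∃ φ : (ℝ × ℝ) ≃ (ℝ × ℝ), ContDiff ℝ ∞ φ ∧ ContDiff ℝ ∞ φ.symm ∧
    PullsBackMetricOn x x' φ Set.univ

/-- Some non-empty open piece of `x` is mapped isometrically into `x'`. -/
def LocallyIsometricSurfaces (x x' : ParamSurface) : Prop :=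
  ∃ (U : Set (ℝ × ℝ)) (φ : ℝ × ℝ → ℝ × ℝ), IsOpen U ∧ U.Nonempty ∧ ContDiffOn ℝ ∞ φ U ∧
    PullsBackMetricOn x x' φ U

/-- `x` and `x'` (isothermally parametrized) belong to the same associated family: after an
orientation preserving change of parameters they have the same metric and mean curvature, and
their Hopf differentials differ by a constant factor `exp (i θ)`. -/
def SameAssociatedFamily (x x' : ParamSurface) : Prop :=
  ∃ (φ : (ℝ × ℝ) ≃ (ℝ × ℝ)) (θ : ℝ), ContDiff ℝ ∞ φ ∧ ContDiff ℝ ∞ φ.symm ∧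
    (∀ p, 0 < (fderiv ℝ φ p).det) ∧
    PullsBackMetricOn x x' φ Set.univ ∧
    (∀ p, meanCurvature x' (φ p) = meanCurvature x p) ∧
    ∀ p w, hopfDifferential x' (φ p) (fderiv ℝ φ p w) =
      Complex.exp (Complex.I * (θ : ℂ)) * hopfDifferential x p w

/-! The helicoids of constant mean curvature. Functions of `u` are evaluated at
`(b u, a / b)`. -/

def helicoidC₁ (a b : ℝ) : ℝ := √((1 - a ^ 2) * (b ^ 2 - 1))

def helicoidC₂ (a b : ℝ) : ℝ := a ^ 2 + b ^ 2 - 1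

/-- The function `g`; for `a = 1` one has `c₁ = 0`, and `g` is `0`. -/
def helicoidG (a b u : ℝ) : ℝ :=
  helicoidC₁ a b / b * ellipticPi (jacobiAm (b * u) (a / b)) (a ^ 2) (a / b)

/-- The smooth function `√(1 - a² sn²)`; for `a = 1` this square root is read as `cn`. -/
def helicoidRoot (a b u : ℝ) : ℝ :=
  if a = 1 then jacobiCn (b * u) (a / b)
  else √(1 - a ^ 2 * jacobiSn (b * u) (a / b) ^ 2)

/-- `a (b cn dn - i c₁ sn) / √(1 - a² sn²)`; for `a = 1` (where `c₁ = 0`, and the root is `cn`)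
the factor `cn` cancels and this is `b dn`. -/
def helicoidQuot (a b u : ℝ) : ℂ :=
  let k := a / b
  if a = 1 then ((b * jacobiDn (b * u) k : ℝ) : ℂ)
  else (a : ℂ) * (((b * jacobiCn (b * u) k * jacobiDn (b * u) k : ℝ) : ℂ)
      - Complex.I * ((helicoidC₁ a b * jacobiSn (b * u) k : ℝ) : ℂ))
    / ((helicoidRoot a b u : ℝ) : ℂ)

/-- The helicoid with parameters `H ≠ 0` and `0 ≤ a ≤ 1 ≤ b`. -/
def cmcHelicoid (H a b : ℝ) : ParamSurface := fun p =>
  let u := p.1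
  let v := p.2
  let k := a / b
  (-1 / (2 * H)) • toE3
    (Complex.exp (Complex.I * (v : ℂ)) * Complex.exp (Complex.I * (helicoidG a b u : ℂ)) *
      ((helicoidRoot a b u : ℂ) + helicoidQuot a b u))
    (-a * jacobiSn (b * u) k
      + ((b ^ 2 - 1) * u - b * ellipticE (jacobiAm (b * u) k) k)
      + helicoidC₁ a b * v)

end

/-! Write S = a sn, C = a cn, D = b dn as functions of u. Then S' = CD, C' = -SD, D' = -SC, while C²
= a² - S² and D² = b² - S² (`EllipticTriple`). In the cylindrical frame rotated by the angle v +
g(u), the surface -2H𝐱 has components (r + K, -BS, z + c₁v), where r² = 1 - S², rK = CD, Br = c₁ and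
g'r = B; its Gauss map has components (r, 0, -S). For a = 1 the function r = cn may vanish, so
`HelicoidProfile` records these relations without dividing by r. All formulas of (i) are polynomial
consequences of r² + S² = 1, K² + B² = c₂ - S² and Br = c₁; in particular the conformal factor is (r
+ K)² + B² = (C + D)².

For (ii), if a/b = a'/b', the homothety with ratio t = b/b' carries one metric to the other, and the
Hopf differentials agree up to a phase because |4HQ| = b² - a² scales by t²
(`sameAssociatedFamily_of_div_eq`). The implications from 2 to 3 and from 3 to 4 only forget data.
Conversely, (log(C + D))'' = -CD, so the Gauss curvature is 4H²CD/(C + D)², and a local isometry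
preserves it (`EllipticTriple.curvature_eq`). With δ = b² - a² = D² - C², one has δ²/(C + D)⁴ = 1 -
4CD/(C + D)², so δ/(C + D)² is preserved too. Differentiating this and comparing gradients gives
δS'² = δ'S², where from here on primes refer to the second surface; algebra gives δC'² = δ'C².
Adding the two yields δa'² = δ'a², hence ab' = a'b (`EllipticTriple.modulus_eq`). -/

/-! ### Elliptic integrals and Jacobi's elliptic functions. -/

theorem hasDerivAt_integral_of_continuousOn {f : ℝ → ℝ} {φ : ℝ} (hm : Measurable f)
    (hc : ∀ θ ∈ Set.uIcc 0 φ, ContinuousAt f θ) :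
    HasDerivAt (fun φ => ∫ θ in (0 : ℝ)..φ, f θ) (f φ) φ :=
  intervalIntegral.integral_hasDerivAt_right
    (ContinuousOn.intervalIntegrable fun θ hθ => (hc θ hθ).continuousWithinAt)
    hm.stronglyMeasurable.stronglyMeasurableAtFilter (hc φ Set.right_mem_uIcc)

theorem one_sub_mul_sin_sq_pos {k θ : ℝ} (hk : k ^ 2 < 1) : 0 < 1 - k ^ 2 * Real.sin θ ^ 2 := by
  nlinarith [Real.sin_sq_le_one θ, sq_nonneg (Real.sin θ), sq_nonneg k]

theorem ellipticDomain_of_lt_one {k : ℝ} (h0 : 0 ≤ k) (h1 : k < 1) :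
    ellipticDomain k = Set.univ := by
  refine Set.eq_univ_of_forall fun φ θ _ => ?_
  have := one_sub_mul_sin_sq_pos (k := k) (θ := θ) (by nlinarith)
  linarith

theorem ellipticDomain_one : ellipticDomain 1 = Set.Ioo (-(Real.pi / 2)) (Real.pi / 2) := by
  have hpi := Real.pi_pos
  ext φ
  constructor
  · intro h
    by_contra hφ
    have key : ∃ θ ∈ Set.uIcc 0 φ, Real.sin θ ^ 2 = 1 := by
      rw [Set.mem_Ioo, not_and_or, not_lt, not_lt] at hφ
      rcases hφ with hφ | hφ
      · exact ⟨-(Real.pi / 2), by rw [Set.mem_uIcc]; right; constructor <;> linarith, by simp⟩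
      · exact ⟨Real.pi / 2, by rw [Set.mem_uIcc]; left; constructor <;> linarith, by simp⟩
    obtain ⟨θ, hθ, hs⟩ := key
    have := h θ hθ
    rw [hs] at this
    norm_num at this
  · rintro ⟨h1, h2⟩ θ hθ
    have hc : 0 < Real.cos θ := by
      apply Real.cos_pos_of_mem_Ioo
      rw [Set.mem_uIcc] at hθ
      rcases hθ with hθ | hθ <;> constructor <;> linarith [hθ.1, hθ.2]
    nlinarith [Real.sin_sq_add_cos_sq θ]

theorem ellipticDomain_cases {k : ℝ} (h0 : 0 ≤ k) (h1 : k ≤ 1) :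
    IsOpen (ellipticDomain k) ∧ Convex ℝ (ellipticDomain k) := by
  rcases h1.lt_or_eq with h | rfl
  · rw [ellipticDomain_of_lt_one h0 h]
    exact ⟨isOpen_univ, convex_univ⟩
  · rw [ellipticDomain_one]
    exact ⟨isOpen_Ioo, convex_Ioo _ _⟩

theorem one_sub_pos_of_mem_ellipticDomain {k φ : ℝ} (h : φ ∈ ellipticDomain k) :
    0 < 1 - k ^ 2 * Real.sin φ ^ 2 := by
  have := h φ Set.right_mem_uIcc
  linarith

theorem hasDerivAt_ellipticF {k φ : ℝ} (h : φ ∈ ellipticDomain k) :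
    HasDerivAt (fun φ => ellipticF φ k) (1 / √(1 - k ^ 2 * Real.sin φ ^ 2)) φ := by
  refine hasDerivAt_integral_of_continuousOn
    (f := fun θ => 1 / √(1 - k ^ 2 * Real.sin θ ^ 2)) (by fun_prop) fun θ hθ => ?_
  have hpos : 0 < √(1 - k ^ 2 * Real.sin θ ^ 2) := Real.sqrt_pos.2 (by linarith [h θ hθ])
  exact ContinuousAt.div (by fun_prop) (by fun_prop) hpos.ne'

theorem hasDerivAt_ellipticE (k φ : ℝ) :
    HasDerivAt (fun φ => ellipticE φ k) (√(1 - k ^ 2 * Real.sin φ ^ 2)) φ :=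
  hasDerivAt_integral_of_continuousOn
    (f := fun θ => √(1 - k ^ 2 * Real.sin θ ^ 2)) (by fun_prop) fun θ _ => by fun_prop

theorem hasDerivAt_ellipticPi {k φ a : ℝ} (ha : a ^ 2 < 1) (h : φ ∈ ellipticDomain k) :
    HasDerivAt (fun φ => ellipticPi φ (a ^ 2) k)
      (1 / ((1 - a ^ 2 * Real.sin φ ^ 2) * √(1 - k ^ 2 * Real.sin φ ^ 2))) φ := by
  refine hasDerivAt_integral_of_continuousOn
    (f := fun θ => 1 / ((1 - a ^ 2 * Real.sin θ ^ 2) * √(1 - k ^ 2 * Real.sin θ ^ 2)))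
    (by fun_prop) fun θ hθ => ?_
  have hpos : 0 < √(1 - k ^ 2 * Real.sin θ ^ 2) := Real.sqrt_pos.2 (by linarith [h θ hθ])
  have hpos' := one_sub_mul_sin_sq_pos (θ := θ) ha
  exact ContinuousAt.div (by fun_prop) (by fun_prop) (mul_pos hpos' hpos).ne'

theorem strictMonoOn_ellipticF {k : ℝ} (h0 : 0 ≤ k) (h1 : k ≤ 1) :
    StrictMonoOn (fun φ => ellipticF φ k) (ellipticDomain k) := by
  obtain ⟨ho, hc⟩ := ellipticDomain_cases h0 h1
  refine strictMonoOn_of_deriv_pos hc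
    (fun φ hφ => (hasDerivAt_ellipticF hφ).continuousAt.continuousWithinAt) fun φ hφ => ?_
  rw [ho.interior_eq] at hφ
  rw [(hasDerivAt_ellipticF hφ).deriv]
  exact div_pos one_pos (Real.sqrt_pos.2 (one_sub_pos_of_mem_ellipticDomain hφ))

/-- The integrand is at least 1, so F(φ) - φ is monotone and |F(φ)| ≥ |φ|; the intermediate value
theorem then applies. -/
theorem surjOn_ellipticF_of_lt_one {k : ℝ} (h0 : 0 ≤ k) (h1 : k < 1) :
    Set.SurjOn (fun φ => ellipticF φ k) (ellipticDomain k) Set.univ := by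
  have hd : ∀ φ, HasDerivAt (fun φ => ellipticF φ k) (1 / √(1 - k ^ 2 * Real.sin φ ^ 2)) φ :=
    fun φ => hasDerivAt_ellipticF (by rw [ellipticDomain_of_lt_one h0 h1]; trivial)
  have hmono : Monotone fun φ => ellipticF φ k - φ := by
    refine monotone_of_deriv_nonneg
      (fun φ => ((hd φ).sub (hasDerivAt_id φ)).differentiableAt) fun φ => ?_
    rw [((hd φ).fun_sub (hasDerivAt_id' φ)).deriv, sub_nonneg, le_div_iff₀, one_mul]
    · exact Real.sqrt_le_one.2 (by nlinarith [mul_nonneg (sq_nonneg k) (sq_nonneg (Real.sin φ))])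
    · exact Real.sqrt_pos.2 (one_sub_mul_sin_sq_pos (by nlinarith))
  have hz : ellipticF 0 k = 0 := by simp [ellipticF]
  intro u _
  have hcont : Continuous fun φ => ellipticF φ k :=
    continuous_iff_continuousAt.2 fun φ => (hd φ).continuousAt
  obtain ⟨φ, hφ⟩ := mem_range_of_exists_le_of_exists_ge hcont (c := u)
    ⟨-|u|, by
      have := hmono (neg_nonpos.2 (abs_nonneg u)); simp only [hz] at this
      linarith [neg_abs_le u]⟩
    ⟨|u|, by
      have := hmono (abs_nonneg u); simp only [hz] at this
      linarith [le_abs_self u]⟩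
  exact ⟨φ, by rw [ellipticDomain_of_lt_one h0 h1]; trivial, hφ⟩

/-- For k = 1 the integrand is 1/cos, the derivative of arsinh ∘ tan. The closed form supplies the
preimage arctan (sinh u) needed for surjectivity. -/
theorem ellipticF_one {φ : ℝ} (h : φ ∈ ellipticDomain 1) :
    ellipticF φ 1 = Real.arsinh (Real.tan φ) := by
  have hd : ∀ θ ∈ ellipticDomain 1,
      HasDerivAt (fun φ => Real.arsinh (Real.tan φ)) (1 / √(1 - 1 ^ 2 * Real.sin θ ^ 2)) θ := by
    intro θ hθ
    rw [ellipticDomain_one] at hθ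
    have hc := Real.cos_pos_of_mem_Ioo hθ
    have h1 := (Real.hasDerivAt_tan hc.ne').arsinh
    convert h1 using 1
    have h2 : 1 + Real.tan θ ^ 2 = (1 / Real.cos θ) ^ 2 := by
      rw [Real.tan_eq_sin_div_cos]
      field_simp
      linarith [Real.sin_sq_add_cos_sq θ]
    have h3 : 1 - 1 ^ 2 * Real.sin θ ^ 2 = Real.cos θ ^ 2 := by
      linarith [Real.sin_sq_add_cos_sq θ]
    rw [h2, h3, Real.sqrt_sq hc.le, Real.sqrt_sq (by positivity), smul_eq_mul]
    field_simp
  obtain ⟨ho, hc⟩ := ellipticDomain_cases zero_le_one le_rfl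
  have h0 : (0 : ℝ) ∈ ellipticDomain 1 := by
    rw [ellipticDomain_one]; constructor <;> linarith [Real.pi_pos]
  have := hc.is_const_of_fderivWithin_eq_zero (𝕜 := ℝ)
    (f := fun φ => ellipticF φ 1 - Real.arsinh (Real.tan φ))
    (fun θ hθ => ((hasDerivAt_ellipticF hθ).sub
      (hd θ hθ)).differentiableAt.differentiableWithinAt)
    (fun θ hθ => by
      rw [fderivWithin_of_isOpen ho hθ]
      have := (hasDerivAt_ellipticF hθ).fun_sub (hd θ hθ)
      rw [sub_self] at this
      ext
      simpa using this.deriv) h h0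
  simp only [ellipticF, intervalIntegral.integral_same, Real.tan_zero, Real.arsinh_zero,
    sub_zero] at this
  simp only [ellipticF]
  linarith

theorem surjOn_ellipticF {k : ℝ} (h0 : 0 ≤ k) (h1 : k ≤ 1) :
    Set.SurjOn (fun φ => ellipticF φ k) (ellipticDomain k) Set.univ := by
  rcases h1.lt_or_eq with h | rfl
  · exact surjOn_ellipticF_of_lt_one h0 h
  · intro u _
    have hm : Real.arctan (Real.sinh u) ∈ ellipticDomain 1 := by
      rw [ellipticDomain_one]; exact Real.arctan_mem_Ioo _
    refine ⟨_, hm, ?_⟩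
    simp only
    rw [ellipticF_one hm, Real.tan_arctan, Real.arsinh_sinh]

theorem jacobiAm_mem {k : ℝ} (h0 : 0 ≤ k) (h1 : k ≤ 1) (u : ℝ) :
    jacobiAm u k ∈ ellipticDomain k :=
  Function.invFunOn_mem (surjOn_ellipticF h0 h1 (Set.mem_univ u))

theorem ellipticF_jacobiAm {k : ℝ} (h0 : 0 ≤ k) (h1 : k ≤ 1) (u : ℝ) :
    ellipticF (jacobiAm u k) k = u :=
  Function.invFunOn_eq (f := fun φ => ellipticF φ k)
    (surjOn_ellipticF h0 h1 (Set.mem_univ u))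

theorem jacobiDn_pos {k : ℝ} (h0 : 0 ≤ k) (h1 : k ≤ 1) (u : ℝ) : 0 < jacobiDn u k :=
  Real.sqrt_pos.2 (one_sub_pos_of_mem_ellipticDomain (jacobiAm_mem h0 h1 u))

theorem jacobiDn_sq {k : ℝ} (h0 : 0 ≤ k) (h1 : k ≤ 1) (u : ℝ) :
    jacobiDn u k ^ 2 = 1 - k ^ 2 * jacobiSn u k ^ 2 :=
  Real.sq_sqrt (one_sub_pos_of_mem_ellipticDomain (jacobiAm_mem h0 h1 u)).le

theorem jacobiSn_sq_add_jacobiCn_sq (u k : ℝ) : jacobiSn u k ^ 2 + jacobiCn u k ^ 2 = 1 :=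
  Real.sin_sq_add_cos_sq _

theorem jacobiCn_one_pos (u : ℝ) : 0 < jacobiCn u 1 := by
  have := jacobiAm_mem zero_le_one le_rfl u
  rw [ellipticDomain_one] at this
  exact Real.cos_pos_of_mem_Ioo this

theorem strictMono_jacobiAm {k : ℝ} (h0 : 0 ≤ k) (h1 : k ≤ 1) :
    StrictMono fun u => jacobiAm u k := by
  intro u v huv
  rw [← (strictMonoOn_ellipticF h0 h1).lt_iff_lt (jacobiAm_mem h0 h1 u) (jacobiAm_mem h0 h1 v)]
  simpa only [ellipticF_jacobiAm h0 h1] using huv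

/-- A monotone function whose image is a neighbourhood of each of its values has no jumps. -/
theorem continuous_jacobiAm {k : ℝ} (h0 : 0 ≤ k) (h1 : k ≤ 1) :
    Continuous fun u => jacobiAm u k := by
  refine continuous_iff_continuousAt.2 fun u => ?_
  refine continuousAt_of_monotoneOn_of_image_mem_nhds
    ((strictMono_jacobiAm h0 h1).monotone.monotoneOn Set.univ) Filter.univ_mem ?_
  have himg : (fun u => jacobiAm u k) '' Set.univ = ellipticDomain k := by
    refine Set.Subset.antisymm ?_ fun φ hφ => ?_
    · rintro _ ⟨v, -, rfl⟩
      exact jacobiAm_mem h0 h1 v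
    · refine ⟨ellipticF φ k, trivial, (strictMonoOn_ellipticF h0 h1).injOn
        (jacobiAm_mem h0 h1 _) hφ ?_⟩
      exact ellipticF_jacobiAm h0 h1 _
  rw [himg]
  exact (ellipticDomain_cases h0 h1).1.mem_nhds (jacobiAm_mem h0 h1 u)

theorem hasDerivAt_jacobiAm {k : ℝ} (h0 : 0 ≤ k) (h1 : k ≤ 1) (u : ℝ) :
    HasDerivAt (fun u => jacobiAm u k) (jacobiDn u k) u := by
  have h := (hasDerivAt_ellipticF (jacobiAm_mem h0 h1 u)).of_local_left_inverse
    (continuous_jacobiAm h0 h1).continuousAt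
    (div_pos one_pos (jacobiDn_pos h0 h1 u)).ne'
    (Filter.Eventually.of_forall fun v => ellipticF_jacobiAm h0 h1 v)
  simpa [jacobiDn, jacobiSn] using h

/-- Bootstrapping from am' = √(1 - k² sin² am), whose radicand stays positive: if am is Cⁿ, so is
its derivative. -/
theorem contDiff_jacobiAm {k : ℝ} (h0 : 0 ≤ k) (h1 : k ≤ 1) :
    ContDiff ℝ ∞ fun u => jacobiAm u k := by
  rw [contDiff_infty]
  intro n
  induction n with
  | zero => exact contDiff_zero.2 (continuous_jacobiAm h0 h1)
  | succ n ih =>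
    rw [Nat.cast_add, Nat.cast_one, contDiff_succ_iff_deriv]
    refine ⟨fun u => (hasDerivAt_jacobiAm h0 h1 u).differentiableAt, by simp, ?_⟩
    rw [show deriv (fun u => jacobiAm u k) = fun u => √(1 - k ^ 2 * Real.sin (jacobiAm u k) ^ 2)
      from funext fun u => (hasDerivAt_jacobiAm h0 h1 u).deriv]
    refine ContDiff.sqrt ?_ fun u =>
      (one_sub_pos_of_mem_ellipticDomain (jacobiAm_mem h0 h1 u)).ne'
    fun_prop

theorem contDiff_jacobiSn {k : ℝ} (h0 : 0 ≤ k) (h1 : k ≤ 1) :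
    ContDiff ℝ ∞ fun u => jacobiSn u k := (contDiff_jacobiAm h0 h1).sin

theorem contDiff_jacobiCn {k : ℝ} (h0 : 0 ≤ k) (h1 : k ≤ 1) :
    ContDiff ℝ ∞ fun u => jacobiCn u k := (contDiff_jacobiAm h0 h1).cos

theorem contDiff_jacobiDn {k : ℝ} (h0 : 0 ≤ k) (h1 : k ≤ 1) :
    ContDiff ℝ ∞ fun u => jacobiDn u k := by
  have := contDiff_jacobiSn h0 h1
  exact ContDiff.sqrt (by fun_prop) fun u =>
    (one_sub_pos_of_mem_ellipticDomain (jacobiAm_mem h0 h1 u)).ne'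

theorem hasDerivAt_jacobiSn {k : ℝ} (h0 : 0 ≤ k) (h1 : k ≤ 1) (u : ℝ) :
    HasDerivAt (fun u => jacobiSn u k) (jacobiCn u k * jacobiDn u k) u :=
  (hasDerivAt_jacobiAm h0 h1 u).sin

theorem hasDerivAt_jacobiCn {k : ℝ} (h0 : 0 ≤ k) (h1 : k ≤ 1) (u : ℝ) :
    HasDerivAt (fun u => jacobiCn u k) (-jacobiSn u k * jacobiDn u k) u :=
  (hasDerivAt_jacobiAm h0 h1 u).cos

theorem hasDerivAt_jacobiDn {k : ℝ} (h0 : 0 ≤ k) (h1 : k ≤ 1) (u : ℝ) :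
    HasDerivAt (fun u => jacobiDn u k) (-(k ^ 2 * jacobiSn u k * jacobiCn u k)) u := by
  have h := ((((hasDerivAt_jacobiSn h0 h1 u).pow 2).const_mul (k ^ 2)).const_sub 1).sqrt
    (one_sub_pos_of_mem_ellipticDomain (jacobiAm_mem h0 h1 u)).ne'
  refine h.congr_deriv ?_
  have hd := jacobiDn_pos h0 h1 u
  change _ / (2 * jacobiDn u k) = _
  field_simp
  norm_num
  ring

/-! ### Vectors in a rotating cylindrical frame. -/

/-- The vector with cylindrical components `(a, b, c)` at the angle `φ`. -/
noncomputable def rotVec (φ a b c : ℝ) : E3 :=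
  !₂[a * Real.cos φ - b * Real.sin φ, a * Real.sin φ + b * Real.cos φ, c]

theorem inner_rotVec (φ a b c a' b' c' : ℝ) :
    inner ℝ (rotVec φ a b c) (rotVec φ a' b' c') = a * a' + b * b' + c * c' := by
  simp only [rotVec, PiLp.inner_apply, Fin.sum_univ_three, RCLike.inner_apply, conj_trivial,
    Matrix.cons_val]
  linear_combination (a * a' + b * b') * Real.sin_sq_add_cos_sq φ

theorem rotVec_add (φ a b c a' b' c' : ℝ) :
    rotVec φ a b c + rotVec φ a' b' c' = rotVec φ (a + a') (b + b') (c + c') := by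
  ext i
  fin_cases i <;> simp [rotVec] <;> ring

theorem smul_rotVec (s φ a b c : ℝ) :
    s • rotVec φ a b c = rotVec φ (s * a) (s * b) (s * c) := by
  ext i
  fin_cases i <;> simp [rotVec] <;> ring

theorem crossE3_rotVec (φ a b c a' b' c' : ℝ) :
    crossE3 (rotVec φ a b c) (rotVec φ a' b' c') =
      rotVec φ (b * c' - c * b') (c * a' - a * c') (a * b' - b * a') := by
  ext i
  fin_cases i
  · simp [rotVec, crossE3, cross_apply]; ring
  · simp [rotVec, crossE3, cross_apply]; ring
  · simp [rotVec, crossE3, cross_apply]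
    linear_combination (a * b' - b * a') * Real.sin_sq_add_cos_sq φ

theorem norm_rotVec (φ a b c : ℝ) : ‖rotVec φ a b c‖ = √(a ^ 2 + b ^ 2 + c ^ 2) := by
  rw [norm_eq_sqrt_real_inner, inner_rotVec]
  ring_nf

theorem contDiff_rotVec {φ a b c : ℝ × ℝ → ℝ} (hφ : ContDiff ℝ ∞ φ) (ha : ContDiff ℝ ∞ a)
    (hb : ContDiff ℝ ∞ b) (hc : ContDiff ℝ ∞ c) :
    ContDiff ℝ ∞ fun p => rotVec (φ p) (a p) (b p) (c p) := by
  rw [contDiff_euclidean]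
  intro i
  fin_cases i <;> simp [rotVec] <;> fun_prop

theorem hasFDerivAt_rotVec {g a b z : ℝ → ℝ} {g' a' b' z' c : ℝ} {p : ℝ × ℝ}
    (hg : HasDerivAt g g' p.1) (ha : HasDerivAt a a' p.1) (hb : HasDerivAt b b' p.1)
    (hz : HasDerivAt z z' p.1) :
    HasFDerivAt (fun p : ℝ × ℝ => rotVec (p.2 + g p.1) (a p.1) (b p.1) (z p.1 + c * p.2))
      ((ContinuousLinearMap.fst ℝ ℝ ℝ).smulRight
          (rotVec (p.2 + g p.1) (a' - g' * b p.1) (b' + g' * a p.1) z')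
        + (ContinuousLinearMap.snd ℝ ℝ ℝ).smulRight
          (rotVec (p.2 + g p.1) (-b p.1) (a p.1) c)) p := by
  have hf := hasFDerivAt_fst (𝕜 := ℝ) (p := p)
  have hs := hasFDerivAt_snd (𝕜 := ℝ) (p := p)
  have hφ := hs.add (hg.comp_hasFDerivAt p hf)
  have ha' := ha.comp_hasFDerivAt p hf
  have hb' := hb.comp_hasFDerivAt p hf
  have hz' := hz.comp_hasFDerivAt p hf
  rw [← hasFDerivWithinAt_univ, hasFDerivWithinAt_euclidean]
  intro i
  rw [hasFDerivWithinAt_univ]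
  fin_cases i
  · refine ((ha'.mul hφ.cos).sub (hb'.mul hφ.sin)).congr_fderiv ?_
    ext <;> simp [rotVec] <;> ring
  · refine ((ha'.mul hφ.sin).add (hb'.mul hφ.cos)).congr_fderiv ?_
    ext <;> simp [rotVec] <;> ring
  · refine (hz'.add (hs.const_mul c)).congr_fderiv ?_
    ext <;> simp [rotVec]

/-! ### Fundamental forms of a surface with a helicoid profile. -/

/-- The functions of `u` describing a helicoid of constant mean curvature in a moving frame. -/
structure HelicoidProfile (c₁ c₂ : ℝ) (S r K B g z : ℝ → ℝ) : Prop where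
  contDiff_S : ContDiff ℝ ∞ S
  contDiff_r : ContDiff ℝ ∞ r
  contDiff_K : ContDiff ℝ ∞ K
  contDiff_B : ContDiff ℝ ∞ B
  contDiff_g : ContDiff ℝ ∞ g
  contDiff_z : ContDiff ℝ ∞ z
  deriv_S : ∀ u, HasDerivAt S (r u * K u) u
  deriv_r : ∀ u, HasDerivAt r (-(S u * K u)) u
  deriv_K : ∀ u, HasDerivAt K (-(S u * r u) - deriv g u * B u * S u) u
  deriv_B : ∀ u, HasDerivAt B (deriv g u * K u * S u) u
  deriv_z : ∀ u, HasDerivAt z (-(r u * (r u + K u))) u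
  deriv_g_mul : ∀ u, deriv g u * r u = B u
  B_mul : ∀ u, B u * r u = c₁
  sq_add_sq : ∀ u, r u ^ 2 + S u ^ 2 = 1
  K_sq : ∀ u, K u ^ 2 + B u ^ 2 = c₂ - S u ^ 2
  pos : ∀ u, 0 < (r u + K u) ^ 2 + B u ^ 2

/-- The surface with the given profile. -/
noncomputable def profileSurface (c₁ : ℝ) (S r K B g z : ℝ → ℝ) : ParamSurface := fun p =>
  rotVec (p.2 + g p.1) (r p.1 + K p.1) (-(B p.1 * S p.1)) (z p.1 + c₁ * p.2)

/-- The Gauss map of the surface with the given profile. -/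
noncomputable def profileNormal (S r g : ℝ → ℝ) : ParamSurface := fun p =>
  rotVec (p.2 + g p.1) (r p.1) 0 (-S p.1)

namespace HelicoidProfile

variable {c₁ c₂ : ℝ} {S r K B g z : ℝ → ℝ}

theorem hasDerivAt_g (h : HelicoidProfile c₁ c₂ S r K B g z) (u : ℝ) :
    HasDerivAt g (deriv g u) u :=
  (h.contDiff_g.differentiable (by simp) u).hasDerivAt

theorem contDiff_surface (h : HelicoidProfile c₁ c₂ S r K B g z) :
    ContDiff ℝ ∞ (profileSurface c₁ S r K B g z) := by
  obtain ⟨h1, h2, h3, h4, h5, h6⟩ := h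
  apply contDiff_rotVec <;> fun_prop

theorem contDiff_normal (h : HelicoidProfile c₁ c₂ S r K B g z) :
    ContDiff ℝ ∞ (profileNormal S r g) := by
  obtain ⟨h1, h2, h3, h4, h5, h6⟩ := h
  apply contDiff_rotVec <;> fun_prop

/-- With the orthonormal tangent vectors e = (S, 0, r) and f = (0, 1, 0) of the frame, the partial
derivatives are -(r + K)e + Bf and Be + (r + K)f. They are orthogonal, of equal length, and
perpendicular to (r, 0, -S). -/
theorem hasFDerivAt_surface (h : HelicoidProfile c₁ c₂ S r K B g z) (p : ℝ × ℝ) :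
    HasFDerivAt (profileSurface c₁ S r K B g z)
      ((ContinuousLinearMap.fst ℝ ℝ ℝ).smulRight
          (rotVec (p.2 + g p.1) (-(S p.1 * (r p.1 + K p.1))) (B p.1)
            (-(r p.1 * (r p.1 + K p.1))))
        + (ContinuousLinearMap.snd ℝ ℝ ℝ).smulRight
          (rotVec (p.2 + g p.1) (B p.1 * S p.1) (r p.1 + K p.1) (B p.1 * r p.1))) p := by
  have := hasFDerivAt_rotVec (c := c₁) (h.hasDerivAt_g p.1)
    ((h.deriv_r p.1).fun_add (h.deriv_K p.1)) ((h.deriv_B p.1).fun_mul (h.deriv_S p.1)).fun_neg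
    (h.deriv_z p.1)
  refine this.congr_fderiv ?_
  congr 3
  · ring
  · linear_combination (1 + K p.1 * r p.1) * h.deriv_g_mul p.1 -
      (deriv g p.1 * K p.1) * h.sq_add_sq p.1
  · ring
  · exact (h.B_mul _).symm

theorem hasFDerivAt_normal (h : HelicoidProfile c₁ c₂ S r K B g z) (p : ℝ × ℝ) :
    HasFDerivAt (profileNormal S r g)
      ((ContinuousLinearMap.fst ℝ ℝ ℝ).smulRight
          (rotVec (p.2 + g p.1) (-(S p.1 * K p.1)) (B p.1) (-(r p.1 * K p.1)))
        + (ContinuousLinearMap.snd ℝ ℝ ℝ).smulRight (rotVec (p.2 + g p.1) 0 (r p.1) 0)) p := by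
  have := hasFDerivAt_rotVec (c := 0) (h.hasDerivAt_g p.1) (h.deriv_r p.1)
    (hasDerivAt_const p.1 (0 : ℝ)) (h.deriv_S p.1).fun_neg
  unfold profileNormal
  simpa [h.deriv_g_mul] using this

theorem fderiv_smul_surface (h : HelicoidProfile c₁ c₂ S r K B g z) (s : ℝ) (p w : ℝ × ℝ) :
    fderiv ℝ (fun p => s • profileSurface c₁ S r K B g z p) p w =
      rotVec (p.2 + g p.1)
        (s * (-(S p.1 * (r p.1 + K p.1)) * w.1 + B p.1 * S p.1 * w.2))
        (s * (B p.1 * w.1 + (r p.1 + K p.1) * w.2))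
        (s * (-(r p.1 * (r p.1 + K p.1)) * w.1 + B p.1 * r p.1 * w.2)) := by
  rw [((h.hasFDerivAt_surface p).fun_const_smul s).fderiv]
  simp only [smul_apply, add_apply,
    ContinuousLinearMap.smulRight_apply, ContinuousLinearMap.coe_fst',
    ContinuousLinearMap.coe_snd', smul_rotVec, rotVec_add]
  congr 1 <;> ring

theorem fderiv_normal (h : HelicoidProfile c₁ c₂ S r K B g z) (p w : ℝ × ℝ) :
    fderiv ℝ (profileNormal S r g) p w =
      rotVec (p.2 + g p.1) (-(S p.1 * K p.1) * w.1) (B p.1 * w.1 + r p.1 * w.2)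
        (-(r p.1 * K p.1) * w.1) := by
  rw [(h.hasFDerivAt_normal p).fderiv]
  simp only [add_apply,
    ContinuousLinearMap.smulRight_apply, ContinuousLinearMap.coe_fst',
    ContinuousLinearMap.coe_snd', smul_rotVec, rotVec_add]
  congr 1 <;> ring

theorem gaussMap_eq (h : HelicoidProfile c₁ c₂ S r K B g z) {s : ℝ} (hs : s ≠ 0) :
    gaussMap (fun p => s • profileSurface c₁ S r K B g z p) = profileNormal S r g := by
  funext p
  -- The conformal factor, which is also the length of the cross product of the partial derivatives.
  set m := s ^ 2 * ((r p.1 + K p.1) ^ 2 + B p.1 ^ 2) with hm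
  have hpos : 0 < m := mul_pos (by positivity) (h.pos p.1)
  have hc : crossE3 (fderiv ℝ (fun p => s • profileSurface c₁ S r K B g z p) p (1, 0))
      (fderiv ℝ (fun p => s • profileSurface c₁ S r K B g z p) p (0, 1)) =
      rotVec (p.2 + g p.1) (m * r p.1) (m * 0) (m * -S p.1) := by
    rw [h.fderiv_smul_surface, h.fderiv_smul_surface, crossE3_rotVec, hm]
    congr 1 <;> ring
  have hn : ‖rotVec (p.2 + g p.1) (m * r p.1) (m * 0) (m * -S p.1)‖ = m := by
    rw [norm_rotVec, show (m * r p.1) ^ 2 + (m * 0) ^ 2 + (m * -S p.1) ^ 2 = m ^ 2 by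
      linear_combination m ^ 2 * h.sq_add_sq p.1, Real.sqrt_sq hpos.le]
  simp only [gaussMap]
  rw [hc, hn, ← smul_rotVec, smul_smul, inv_mul_cancel₀ hpos.ne', one_smul, profileNormal]

theorem firstForm_smul (h : HelicoidProfile c₁ c₂ S r K B g z) (s : ℝ) (p w w' : ℝ × ℝ) :
    firstForm (fun p => s • profileSurface c₁ S r K B g z p) p w w' =
      s ^ 2 * ((r p.1 + K p.1) ^ 2 + B p.1 ^ 2) * (w.1 * w'.1 + w.2 * w'.2) := by
  rw [firstForm, h.fderiv_smul_surface, h.fderiv_smul_surface, inner_rotVec]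
  linear_combination s ^ 2 * (-(r p.1 + K p.1) * w.1 + B p.1 * w.2) *
    (-(r p.1 + K p.1) * w'.1 + B p.1 * w'.2) * h.sq_add_sq p.1

theorem secondForm_smul (h : HelicoidProfile c₁ c₂ S r K B g z) (s : ℝ) (p w w' : ℝ × ℝ) :
    secondForm (fun p => s • profileSurface c₁ S r K B g z p) (profileNormal S r g) p w w' =
      -s * (((r p.1 + K p.1) * K p.1 + B p.1 ^ 2) * (w.1 * w'.1)
        + B p.1 * r p.1 * (w.1 * w'.2 + w.2 * w'.1)
        + (r p.1 + K p.1) * r p.1 * (w.2 * w'.2)) := by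
  rw [secondForm, h.fderiv_smul_surface, h.fderiv_normal, inner_rotVec]
  linear_combination s * (-(r p.1 + K p.1) * w.1 + B p.1 * w.2) * K p.1 * w'.1 * h.sq_add_sq p.1

theorem thirdForm_normal (h : HelicoidProfile c₁ c₂ S r K B g z) (p w w' : ℝ × ℝ) :
    thirdForm (profileNormal S r g) p w w' =
      (c₂ - S p.1 ^ 2) * (w.1 * w'.1) + c₁ * (w.1 * w'.2 + w.2 * w'.1)
        + (1 - S p.1 ^ 2) * (w.2 * w'.2) := by
  rw [thirdForm, h.fderiv_normal, h.fderiv_normal, inner_rotVec, ← h.K_sq, ← h.B_mul p.1]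
  linear_combination (K p.1 ^ 2 * w.1 * w'.1 + w.2 * w'.2) * h.sq_add_sq p.1

/-- L + N is -s((r + K)² + B²), while the conformal factor is s²((r + K)² + B²). -/
theorem meanCurvature_smul (h : HelicoidProfile c₁ c₂ S r K B g z) {s : ℝ} (hs : s ≠ 0)
    (p : ℝ × ℝ) :
    meanCurvature (fun p => s • profileSurface c₁ S r K B g z p) p = -1 / (2 * s) := by
  simp only [meanCurvature, h.gaussMap_eq hs, h.firstForm_smul, h.secondForm_smul]
  have := (h.pos p.1).ne'
  rw [div_eq_div_iff (by simp; tauto) (by simpa using hs)]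
  ring

theorem hopfDifferential_smul (h : HelicoidProfile c₁ c₂ S r K B g z) {s : ℝ} (hs : s ≠ 0)
    (p w : ℝ × ℝ) :
    hopfDifferential (fun p => s • profileSurface c₁ S r K B g z p) p w =
      -(s : ℂ) / 2 * ((c₂ - 1 : ℝ) - 2 * Complex.I * (c₁ : ℝ))
        * ((w.1 : ℂ) + Complex.I * (w.2 : ℂ)) ^ 2 := by
  simp only [hopfDifferential, h.gaussMap_eq hs, h.secondForm_smul]
  have hK : (c₂ - 1 : ℝ) = K p.1 ^ 2 + B p.1 ^ 2 - r p.1 ^ 2 := by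
    linear_combination -h.K_sq p.1 + h.sq_add_sq p.1
  rw [hK, ← h.B_mul p.1]
  push_cast
  ring

/-- The scale s = 1 gives mean curvature -1/2, so the multiple of the normal that is added is -1. -/
theorem cgcCompanion_eq (h : HelicoidProfile c₁ c₂ S r K B g z) :
    cgcCompanion (profileSurface c₁ S r K B g z) = fun p =>
      profileSurface c₁ S r K B g z p - profileNormal S r g p := by
  have h1 := h.meanCurvature_smul one_ne_zero
  have h2 := h.gaussMap_eq one_ne_zero
  simp only [one_smul] at h1 h2
  funext p
  simp only [cgcCompanion]
  rw [h1, h2]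
  norm_num
  rw [sub_eq_add_neg]

/-- In the tangent frame e = (S, 0, r), f = (0, 1, 0), the partial derivatives of the normal are -Ke
+ Bf and rf; subtracting them leaves -re and Be + Kf. -/
theorem fderiv_companion (h : HelicoidProfile c₁ c₂ S r K B g z) (p w : ℝ × ℝ) :
    fderiv ℝ (fun p => profileSurface c₁ S r K B g z p - profileNormal S r g p) p w =
      rotVec (p.2 + g p.1) (S p.1 * (-r p.1 * w.1 + B p.1 * w.2)) (K p.1 * w.2)
        (r p.1 * (-r p.1 * w.1 + B p.1 * w.2)) := by
  have h1 := h.fderiv_smul_surface 1 p w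
  simp only [one_smul] at h1
  rw [fderiv_fun_sub (h.hasFDerivAt_surface p).differentiableAt
    (h.hasFDerivAt_normal p).differentiableAt, sub_apply, h1,
    h.fderiv_normal, sub_eq_iff_eq_add, rotVec_add]
  congr 1 <;> ring

theorem firstForm_companion (h : HelicoidProfile c₁ c₂ S r K B g z) (p w w' : ℝ × ℝ) :
    firstForm (fun p => profileSurface c₁ S r K B g z p - profileNormal S r g p) p w w' =
      (1 - S p.1 ^ 2) * (w.1 * w'.1) - c₁ * (w.1 * w'.2 + w.2 * w'.1)
        + (c₂ - S p.1 ^ 2) * (w.2 * w'.2) := by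
  rw [firstForm, h.fderiv_companion, h.fderiv_companion, inner_rotVec, ← h.K_sq, ← h.B_mul p.1]
  linear_combination ((-r p.1 * w.1 + B p.1 * w.2) * (-r p.1 * w'.1 + B p.1 * w'.2)
    + w.1 * w'.1) * h.sq_add_sq p.1

theorem secondForm_companion (h : HelicoidProfile c₁ c₂ S r K B g z) (p w w' : ℝ × ℝ) :
    secondForm (fun p => profileSurface c₁ S r K B g z p - profileNormal S r g p)
        (profileNormal S r g) p w w' =
      -(r p.1 * K p.1) * (w.1 * w'.1 + w.2 * w'.2) := by
  rw [secondForm, h.fderiv_companion, h.fderiv_normal, inner_rotVec]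
  linear_combination (K p.1 * w'.1 * (-r p.1 * w.1 + B p.1 * w.2)) * h.sq_add_sq p.1

end HelicoidProfile

/-! ### From the equations of the elliptic functions to a profile. -/

/-- The equations satisfied by `S = a sn`, `C = a cn`, `D = b dn` as functions of `u`. -/
structure EllipticTriple (a b : ℝ) (S C D : ℝ → ℝ) : Prop where
  contDiff_S : ContDiff ℝ ∞ S
  contDiff_C : ContDiff ℝ ∞ C
  contDiff_D : ContDiff ℝ ∞ D
  deriv_S : ∀ u, HasDerivAt S (C u * D u) u
  deriv_C : ∀ u, HasDerivAt C (-(S u * D u)) u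
  deriv_D : ∀ u, HasDerivAt D (-(S u * C u)) u
  C_sq : ∀ u, C u ^ 2 = a ^ 2 - S u ^ 2
  D_sq : ∀ u, D u ^ 2 = b ^ 2 - S u ^ 2
  pos : ∀ u, 0 < C u + D u

theorem helicoidC₁_sq {a b : ℝ} (ha : a ^ 2 ≤ 1) (hb : 1 ≤ b ^ 2) :
    helicoidC₁ a b ^ 2 = (1 - a ^ 2) * (b ^ 2 - 1) :=
  Real.sq_sqrt (mul_nonneg (by linarith) (by linarith))

theorem helicoidC₁_one (b : ℝ) : helicoidC₁ 1 b = 0 := by simp [helicoidC₁]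

/-- The generic case, in which r > 0 permits K = CD/r, B = c/r and g' = c/r². -/
theorem EllipticTriple.profile {a b c : ℝ} {S C D r g z : ℝ → ℝ} (h : EllipticTriple a b S C D)
    (hc : c ^ 2 = (1 - a ^ 2) * (b ^ 2 - 1)) (hr : ∀ u, 0 < r u) (hr2 : ∀ u, r u ^ 2 = 1 - S u ^ 2)
    (hg : ∀ u, HasDerivAt g (c / r u ^ 2) u)
    (hz : ∀ u, HasDerivAt z (-(r u ^ 2 + C u * D u)) u) :
    HelicoidProfile c (helicoidC₂ a b) S r (fun u => C u * D u / r u) (fun u => c / r u) g z := by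
  obtain ⟨sS, sC, sD, dS, dC, dD, hC, hD, hpos⟩ := h
  have hr0 : ∀ u, r u ≠ 0 := fun u => (hr u).ne'
  have hrs : r = fun u => √(1 - S u ^ 2) := funext fun u => by
    rw [← hr2, Real.sqrt_sq (hr u).le]
  have hS : ∀ u, 1 - S u ^ 2 ≠ 0 := fun u => by rw [← hr2]; exact pow_ne_zero 2 (hr0 u)
  have sr : ContDiff ℝ ∞ r := by
    rw [hrs]
    exact ContDiff.sqrt (by fun_prop) hS
  have dr : ∀ u, HasDerivAt r (-(S u * (C u * D u / r u))) u := by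
    intro u
    have := (((dS u).fun_pow 2).const_sub 1).sqrt (hS u)
    rw [← hrs, ← hr2, Real.sqrt_sq (hr u).le] at this
    refine this.congr_deriv ?_
    have := hr0 u
    field_simp
    norm_num
    ring
  have dg : deriv g = fun u => c / r u ^ 2 := funext fun u => (hg u).deriv
  -- This is the identity (a² - S²)(b² - S²) + (1 - a²)(b² - 1) = (1 - S²)(a² + b² - 1 - S²).
  have key : ∀ u, (C u * D u) ^ 2 + c ^ 2 = r u ^ 2 * (helicoidC₂ a b - S u ^ 2) := fun u => by
    rw [mul_pow, hC, hD, hc, hr2, helicoidC₂]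
    ring
  have K_sq : ∀ u, (C u * D u / r u) ^ 2 + (c / r u) ^ 2 = helicoidC₂ a b - S u ^ 2 := fun u => by
    rw [div_pow, div_pow, ← add_div, key, mul_div_cancel_left₀ _ (pow_ne_zero 2 (hr0 u))]
  refine ⟨sS, sr, ?_, ?_, ?_, ?_, ?_, dr, ?_, ?_, ?_, ?_, ?_, ?_, K_sq, ?_⟩
  · exact (sC.mul sD).div sr hr0
  · exact contDiff_const.div sr hr0
  · rw [contDiff_infty_iff_deriv, dg]
    exact ⟨fun u => (hg u).differentiableAt,
      contDiff_const.div (sr.pow 2) fun u => pow_ne_zero 2 (hr0 u)⟩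
  · rw [contDiff_infty_iff_deriv, show deriv z = _ from funext fun u => (hz u).deriv]
    exact ⟨fun u => (hz u).differentiableAt, by fun_prop⟩
  · exact fun u => (dS u).congr_deriv (by have := hr0 u; field_simp)
  · intro u
    refine (((dC u).fun_mul (dD u)).fun_div (dr u) (hr0 u)).congr_deriv ?_
    have h1 := key u
    have h2 : C u ^ 2 + D u ^ 2 = a ^ 2 + b ^ 2 - 2 * S u ^ 2 := by rw [hC, hD]; ring
    have h3 := hr2 u
    have := hr0 u
    rw [dg, helicoidC₂] at *
    field_simp
    linear_combination S u * h1 - S u * r u ^ 2 * h2 + S u * r u ^ 2 * h3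
  · intro u
    refine ((hasDerivAt_const u c).fun_div (dr u) (hr0 u)).congr_deriv ?_
    have := hr0 u
    rw [dg]
    field_simp
    ring
  · exact fun u => (hz u).congr_deriv (by have := hr0 u; field_simp)
  · intro u
    have := hr0 u
    rw [dg]
    field_simp
  · exact fun u => div_mul_cancel₀ _ (hr0 u)
  · exact fun u => by rw [hr2]; ring
  · intro u
    have h1 : (r u + C u * D u / r u) ^ 2 + (c / r u) ^ 2 = (C u + D u) ^ 2 := by
      have h2 : r u * (C u * D u / r u) = C u * D u := mul_div_cancel₀ _ (hr0 u)
      have := K_sq u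
      rw [helicoidC₂] at this
      linear_combination this + 2 * h2 + hr2 u - hC u - hD u
    rw [h1]
    exact pow_pos (hpos u) 2

/-- The case a = 1, where r = C can vanish or change sign. Cancelling the factor C in CD/r leaves K
= D, and c₁ = 0 removes B and g. -/
theorem EllipticTriple.profile_one {b : ℝ} {S C D z : ℝ → ℝ} (h : EllipticTriple 1 b S C D)
    (hz : ∀ u, HasDerivAt z (-(C u ^ 2 + C u * D u)) u) :
    HelicoidProfile 0 (helicoidC₂ 1 b) S C D (fun _ => 0) (fun _ => 0) z := by
  obtain ⟨sS, sC, sD, dS, dC, dD, hC, hD, hpos⟩ := h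
  refine ⟨sS, sC, sD, contDiff_const, contDiff_const, ?_, dS, dC, ?_, ?_, ?_, ?_, ?_, ?_, ?_, ?_⟩
  · rw [contDiff_infty_iff_deriv, show deriv z = _ from funext fun u => (hz u).deriv]
    exact ⟨fun u => (hz u).differentiableAt, by fun_prop⟩
  · simpa using dD
  · simpa using fun u => hasDerivAt_const u (0 : ℝ)
  · exact fun u => (hz u).congr_deriv (by ring)
  · simp
  · simp
  · intro u; rw [hC]; ring
  · intro u; rw [hD, helicoidC₂]; ring
  · intro u; simpa using pow_pos (hpos u) 2

/-! ### The concrete helicoids as profile surfaces. -/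

section

variable {a b : ℝ}

theorem helicoid_modulus_mem (h0 : 0 ≤ a) (h1 : a ≤ 1) (hb : 1 ≤ b) :
    0 ≤ a / b ∧ a / b ≤ 1 :=
  ⟨div_nonneg h0 (by linarith), (div_le_one (by linarith)).2 (by linarith)⟩

theorem helicoid_triple (h0 : 0 ≤ a) (h1 : a ≤ 1) (hb : 1 ≤ b) :
    EllipticTriple a b (fun u => a * jacobiSn (b * u) (a / b))
      (fun u => a * jacobiCn (b * u) (a / b)) (fun u => b * jacobiDn (b * u) (a / b)) := by
  obtain ⟨k0, k1⟩ := helicoid_modulus_mem h0 h1 hb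
  have hb0 : b ≠ 0 := by linarith
  have hm : ∀ u : ℝ, HasDerivAt (fun u => b * u) b u := fun u => by
    simpa using (hasDerivAt_id u).const_mul b
  have sm : ContDiff ℝ ∞ fun u : ℝ => b * u := by fun_prop
  have hD : ∀ u, (b * jacobiDn (b * u) (a / b)) ^ 2 =
      b ^ 2 - (a * jacobiSn (b * u) (a / b)) ^ 2 := fun u => by
    rw [mul_pow, jacobiDn_sq k0 k1]
    field_simp
  have hC : ∀ u, (a * jacobiCn (b * u) (a / b)) ^ 2 =
      a ^ 2 - (a * jacobiSn (b * u) (a / b)) ^ 2 := fun u => by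
    linear_combination a ^ 2 * jacobiSn_sq_add_jacobiCn_sq (b * u) (a / b)
  refine ⟨contDiff_const.mul ((contDiff_jacobiSn k0 k1).comp sm),
    contDiff_const.mul ((contDiff_jacobiCn k0 k1).comp sm),
    contDiff_const.mul ((contDiff_jacobiDn k0 k1).comp sm), ?_, ?_, ?_, hC, hD, ?_⟩
  · intro u
    refine (((hasDerivAt_jacobiSn k0 k1 (b * u)).comp u (hm u)).const_mul a).congr_deriv ?_
    ring
  · intro u
    refine (((hasDerivAt_jacobiCn k0 k1 (b * u)).comp u (hm u)).const_mul a).congr_deriv ?_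
    ring
  · intro u
    refine (((hasDerivAt_jacobiDn k0 k1 (b * u)).comp u (hm u)).const_mul b).congr_deriv ?_
    field_simp
  · intro u
    have hd : 0 < b * jacobiDn (b * u) (a / b) := mul_pos (by linarith) (jacobiDn_pos k0 k1 _)
    -- As D² - C² = b² - a², one has |C| < D unless a = b = 1; in that case the modulus is 1 and cn
    -- is itself positive.
    rcases h1.lt_or_eq with h | rfl
    · have : |a * jacobiCn (b * u) (a / b)| < b * jacobiDn (b * u) (a / b) :=
        abs_lt_of_sq_lt_sq (by rw [hC, hD]; nlinarith) hd.le
      linarith [neg_abs_le (a * jacobiCn (b * u) (a / b))]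
    rcases hb.lt_or_eq with h | rfl
    · have : |1 * jacobiCn (b * u) (1 / b)| < b * jacobiDn (b * u) (1 / b) :=
        abs_lt_of_sq_lt_sq (by rw [hC, hD]; nlinarith) hd.le
      linarith [neg_abs_le (1 * jacobiCn (b * u) (1 / b))]
    · have := jacobiCn_one_pos (1 * u)
      rw [div_one] at *
      linarith

/-- The height of the helicoid without the term linear in `v`. -/
noncomputable def helicoidHeight (a b u : ℝ) : ℝ :=
  -a * jacobiSn (b * u) (a / b)
    + ((b ^ 2 - 1) * u - b * ellipticE (jacobiAm (b * u) (a / b)) (a / b))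

/-- The quotient `a b cn dn / √(1 - a² sn²)`, read as `b dn` for `a = 1`. -/
noncomputable def helicoidK (a b u : ℝ) : ℝ :=
  if a = 1 then b * jacobiDn (b * u) (a / b)
  else a * jacobiCn (b * u) (a / b) * (b * jacobiDn (b * u) (a / b)) / helicoidRoot a b u

theorem hasDerivAt_helicoidHeight (h0 : 0 ≤ a) (h1 : a ≤ 1) (hb : 1 ≤ b) (u : ℝ) :
    HasDerivAt (helicoidHeight a b)
      (-(1 - (a * jacobiSn (b * u) (a / b)) ^ 2
        + a * jacobiCn (b * u) (a / b) * (b * jacobiDn (b * u) (a / b)))) u := by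
  have ht := helicoid_triple h0 h1 hb
  obtain ⟨k0, k1⟩ := helicoid_modulus_mem h0 h1 hb
  have hm : HasDerivAt (fun u => b * u) b u := by
    simpa using (hasDerivAt_id u).const_mul b
  have hE : HasDerivAt (fun u => ellipticE (jacobiAm (b * u) (a / b)) (a / b))
      (jacobiDn (b * u) (a / b) * (jacobiDn (b * u) (a / b) * b)) u :=
    HasDerivAt.comp (h := fun u => jacobiAm (b * u) (a / b)) u
      (hasDerivAt_ellipticE (a / b) (jacobiAm (b * u) (a / b)))
      ((hasDerivAt_jacobiAm k0 k1 (b * u)).comp u hm)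
  have := (ht.deriv_S u).fun_neg.fun_add
    (((hasDerivAt_id' u).const_mul (b ^ 2 - 1)).fun_sub (hE.const_mul b))
  have e : helicoidHeight a b = fun u => -(a * jacobiSn (b * u) (a / b))
    + ((b ^ 2 - 1) * u - b * ellipticE (jacobiAm (b * u) (a / b)) (a / b)) := by
    funext u
    rw [helicoidHeight]
    ring
  rw [e]
  refine this.congr_deriv ?_
  linear_combination -ht.D_sq u

theorem hasDerivAt_helicoidG (h0 : 0 ≤ a) (h1 : a < 1) (hb : 1 ≤ b) (u : ℝ) :
    HasDerivAt (helicoidG a b)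
      (helicoidC₁ a b / (1 - a ^ 2 * jacobiSn (b * u) (a / b) ^ 2)) u := by
  obtain ⟨k0, k1⟩ := helicoid_modulus_mem h0 h1.le hb
  have hm : HasDerivAt (fun u => b * u) b u := by
    simpa using (hasDerivAt_id u).const_mul b
  have hb0 : b ≠ 0 := by linarith
  have hP : HasDerivAt (fun u => ellipticPi (jacobiAm (b * u) (a / b)) (a ^ 2) (a / b))
      (1 / ((1 - a ^ 2 * jacobiSn (b * u) (a / b) ^ 2) * jacobiDn (b * u) (a / b)) *
        (jacobiDn (b * u) (a / b) * b)) u :=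
    HasDerivAt.comp (h := fun u => jacobiAm (b * u) (a / b)) u
      (hasDerivAt_ellipticPi (a := a) (by nlinarith) (jacobiAm_mem k0 k1 (b * u)))
      ((hasDerivAt_jacobiAm k0 k1 (b * u)).comp u hm)
  refine (hP.const_mul (helicoidC₁ a b / b)).congr_deriv ?_
  have hd := (jacobiDn_pos k0 k1 (b * u)).ne'
  have hs : 1 - a ^ 2 * jacobiSn (b * u) (a / b) ^ 2 ≠ 0 :=
    (one_sub_mul_sin_sq_pos (by nlinarith)).ne'
  field_simp

theorem helicoidRoot_sq (h0 : 0 ≤ a) (h1 : a ≤ 1) (u : ℝ) :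
    helicoidRoot a b u ^ 2 = 1 - (a * jacobiSn (b * u) (a / b)) ^ 2 := by
  rw [helicoidRoot]
  split_ifs with h
  · subst h
    linarith [jacobiSn_sq_add_jacobiCn_sq (b * u) (1 / b)]
  · have := lt_of_le_of_ne h1 h
    have hs : 0 < 1 - a ^ 2 * jacobiSn (b * u) (a / b) ^ 2 :=
      one_sub_mul_sin_sq_pos (by nlinarith)
    rw [Real.sq_sqrt hs.le]
    ring

theorem helicoidRoot_pos (h0 : 0 ≤ a) (h1 : a < 1) (u : ℝ) : 0 < helicoidRoot a b u := by
  rw [helicoidRoot, if_neg h1.ne]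
  exact Real.sqrt_pos.2 (one_sub_mul_sin_sq_pos (by nlinarith))

theorem helicoid_profile (h0 : 0 ≤ a) (h1 : a ≤ 1) (hb : 1 ≤ b) :
    HelicoidProfile (helicoidC₁ a b) (helicoidC₂ a b) (fun u => a * jacobiSn (b * u) (a / b))
      (helicoidRoot a b) (helicoidK a b) (fun u => helicoidC₁ a b / helicoidRoot a b u)
      (helicoidG a b) (helicoidHeight a b) := by
  have ht := helicoid_triple h0 h1 hb
  have hz := hasDerivAt_helicoidHeight h0 h1 hb
  rcases h1.lt_or_eq with h | rfl
  · have hK : helicoidK a b = fun u => a * jacobiCn (b * u) (a / b) *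
        (b * jacobiDn (b * u) (a / b)) / helicoidRoot a b u := by
      funext u
      rw [helicoidK, if_neg h.ne]
    rw [hK]
    refine ht.profile (helicoidC₁_sq (by nlinarith) (by nlinarith)) (helicoidRoot_pos h0 h)
      (helicoidRoot_sq h0 h1) (fun u => ?_) fun u => ?_
    · rw [helicoidRoot_sq h0 h1, mul_pow]
      exact hasDerivAt_helicoidG h0 h hb u
    · rw [helicoidRoot_sq h0 h1]
      exact hz u
  · have hr : helicoidRoot 1 b = fun u => 1 * jacobiCn (b * u) (1 / b) := by
      funext u
      rw [helicoidRoot, if_pos rfl, one_mul]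
    have hK : helicoidK 1 b = fun u => b * jacobiDn (b * u) (1 / b) := by
      funext u
      rw [helicoidK, if_pos rfl]
    have hg : helicoidG 1 b = fun _ => 0 := by
      funext u
      simp [helicoidG, helicoidC₁_one]
    rw [hr, hK, hg]
    simp only [helicoidC₁_one, zero_div]
    refine ht.profile_one fun u => ?_
    rw [ht.C_sq, one_pow]
    exact hz u

theorem helicoidRoot_mul_helicoidK (h0 : 0 ≤ a) (h1 : a ≤ 1) (u : ℝ) :
    helicoidRoot a b u * helicoidK a b u =
      a * jacobiCn (b * u) (a / b) * (b * jacobiDn (b * u) (a / b)) := by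
  rcases h1.lt_or_eq with h | rfl
  · rw [helicoidK, if_neg h.ne, mul_div_cancel₀ _ (helicoidRoot_pos h0 h u).ne']
  · rw [helicoidK, helicoidRoot, if_pos rfl, if_pos rfl, one_mul]

theorem helicoidQuot_eq (a b u : ℝ) :
    helicoidQuot a b u = (helicoidK a b u : ℂ) - Complex.I *
      (helicoidC₁ a b / helicoidRoot a b u * (a * jacobiSn (b * u) (a / b)) : ℝ) := by
  rw [helicoidQuot, helicoidK]
  split_ifs with h
  · subst h
    simp [helicoidC₁_one]
  · push_cast
    ring

/-- The brace in the parametrization is r + K - iBS, and the phase v + g(u) is the angle of the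
moving frame. -/
theorem cmcHelicoid_eq (H a b : ℝ) :
    cmcHelicoid H a b = fun p => (-1 / (2 * H)) • profileSurface (helicoidC₁ a b)
      (fun u => a * jacobiSn (b * u) (a / b)) (helicoidRoot a b) (helicoidK a b)
      (fun u => helicoidC₁ a b / helicoidRoot a b u) (helicoidG a b) (helicoidHeight a b) p := by
  funext p
  simp only [cmcHelicoid, profileSurface]
  congr 1
  have he : Complex.exp (Complex.I * (p.2 : ℂ)) * Complex.exp (Complex.I * (helicoidG a b p.1 : ℂ))
      = (Real.cos (p.2 + helicoidG a b p.1) : ℂ)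
        + (Real.sin (p.2 + helicoidG a b p.1) : ℂ) * Complex.I := by
    rw [← Complex.exp_add, Complex.ofReal_cos, Complex.ofReal_sin, ← Complex.exp_mul_I]
    push_cast
    ring_nf
  rw [he, helicoidQuot_eq, toE3, rotVec]
  generalize Real.cos (p.2 + helicoidG a b p.1) = c
  generalize Real.sin (p.2 + helicoidG a b p.1) = s
  ext i
  fin_cases i
  · simp
    ring
  · simp
    ring
  · simp [helicoidHeight]

end

/-! ### Conformal maps and invariance of curvature. -/

theorem two_le_infty : (2 : WithTop ℕ∞) ≤ ∞ :=
  WithTop.coe_le_coe.2 (le_top : (2 : ℕ∞) ≤ ⊤)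

theorem fderiv_fderiv_apply_comm {f : ℝ × ℝ → ℝ} {x : ℝ × ℝ} (hf : ContDiffAt ℝ 2 f x)
    (w w' : ℝ × ℝ) :
    fderiv ℝ (fun y => fderiv ℝ f y w) x w' = fderiv ℝ (fun y => fderiv ℝ f y w') x w := by
  have hd : DifferentiableAt ℝ (fderiv ℝ f) x :=
    (hf.fderiv_right (m := 1) (by norm_num)).differentiableAt (by simp)
  have h1 : ∀ w w' : ℝ × ℝ, fderiv ℝ (fun y => fderiv ℝ f y w) x w' =
      fderiv ℝ (fderiv ℝ f) x w' w := fun w w' => by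
    rw [fderiv_clm_apply hd (differentiableAt_const w)]
    simp
  rw [h1, h1]
  exact hf.isSymmSndFDerivAt (by simp) w' w

theorem contDiffOn_fderiv_apply {f : ℝ × ℝ → ℝ} {V : Set (ℝ × ℝ)} (hV : IsOpen V)
    (hf : ContDiffOn ℝ ∞ f V) (w : ℝ × ℝ) : ContDiffOn ℝ ∞ (fun x => fderiv ℝ f x w) V :=
  (hf.fderiv_of_isOpen hV (by simp)).clm_apply contDiffOn_const

theorem hasFDerivAt_of_contDiffOn {f : ℝ × ℝ → ℝ} {V : Set (ℝ × ℝ)} (hV : IsOpen V)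
    (hf : ContDiffOn ℝ ∞ f V) {x : ℝ × ℝ} (hx : x ∈ V) : HasFDerivAt f (fderiv ℝ f x) x :=
  ((hf.contDiffAt (hV.mem_nhds hx)).differentiableAt (by simp)).hasFDerivAt

theorem HasFDerivAt.apply_eq_of_eqOn {f g : ℝ × ℝ → ℝ} {f' g' : ℝ × ℝ →L[ℝ] ℝ}
    {V : Set (ℝ × ℝ)} {x : ℝ × ℝ} (hf : HasFDerivAt f f' x) (hg : HasFDerivAt g g' x)
    (hV : IsOpen V) (hx : x ∈ V) (h : ∀ y ∈ V, f y = g y) (w : ℝ × ℝ) : f' w = g' w := by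
  have := hf.unique (hg.congr_of_eventuallyEq (Filter.eventuallyEq_of_mem (hV.mem_nhds hx) h))
  rw [this]

/-- Near every point, the first component of a conformal map of plane domains is harmonic, and
the square of the norm of its gradient is the conformal factor. -/
theorem exists_harmonic_of_conformal {V : Set (ℝ × ℝ)} (hV : IsOpen V) {x₀ : ℝ × ℝ} (hx₀ : x₀ ∈ V)
    {p q : ℝ × ℝ → ℝ} (hp : ContDiffOn ℝ ∞ p V) (hq : ContDiffOn ℝ ∞ q V) {m : ℝ × ℝ → ℝ}
    (hm : ∀ x ∈ V, 0 < m x)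
    (h : ∀ x ∈ V, ∀ w : ℝ × ℝ,
      fderiv ℝ p x w ^ 2 + fderiv ℝ q x w ^ 2 = m x * (w.1 ^ 2 + w.2 ^ 2)) :
    ∃ W ⊆ V, IsOpen W ∧ x₀ ∈ W ∧ ∀ x ∈ W,
      fderiv ℝ p x (1, 0) ^ 2 + fderiv ℝ p x (0, 1) ^ 2 = m x ∧
      fderiv ℝ (fun x => fderiv ℝ p x (1, 0)) x (1, 0)
        + fderiv ℝ (fun x => fderiv ℝ p x (0, 1)) x (0, 1) = 0 := by
  set J : ℝ × ℝ → ℝ := fun x =>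
    fderiv ℝ p x (1, 0) * fderiv ℝ q x (0, 1) - fderiv ℝ p x (0, 1) * fderiv ℝ q x (1, 0) with hJ
  have sP := contDiffOn_fderiv_apply hV hp
  have sQ := contDiffOn_fderiv_apply hV hq
  have cJ : ContinuousOn J V :=
    (((sP (1, 0)).mul (sQ (0, 1))).sub ((sP (0, 1)).mul (sQ (1, 0)))).continuousOn
  have rel : ∀ x ∈ V, fderiv ℝ p x (1, 0) ^ 2 + fderiv ℝ q x (1, 0) ^ 2 = m x ∧
      fderiv ℝ p x (0, 1) ^ 2 + fderiv ℝ q x (0, 1) ^ 2 = m x ∧ J x ^ 2 = m x ^ 2 := by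
    intro x hx
    have h1 := h x hx (1, 0)
    have h2 := h x hx (0, 1)
    have h3 := h x hx ((1, 0) + (0, 1))
    simp only [map_add, Prod.fst_add, Prod.snd_add] at h1 h2 h3
    have h4 : fderiv ℝ p x (1, 0) * fderiv ℝ p x (0, 1)
        + fderiv ℝ q x (1, 0) * fderiv ℝ q x (0, 1) = 0 := by
      linear_combination (h3 - h1 - h2) / 2
    refine ⟨by linear_combination h1, by linear_combination h2, ?_⟩
    simp only [hJ]
    linear_combination m x * h1 + (fderiv ℝ p x (1, 0) ^ 2 + fderiv ℝ q x (1, 0) ^ 2) * h2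
      - (fderiv ℝ p x (1, 0) * fderiv ℝ p x (0, 1)
        + fderiv ℝ q x (1, 0) * fderiv ℝ q x (0, 1)) * h4
  -- The sign ε allows the map to reverse orientation.
  obtain ⟨ε, hε, hpos⟩ : ∃ ε : ℝ, ε ^ 2 = 1 ∧ 0 < ε * J x₀ := by
    have hne : J x₀ ≠ 0 := fun h0 => by
      have := (rel x₀ hx₀).2.2
      rw [h0] at this
      exact (pow_pos (hm x₀ hx₀) 2).ne (by linarith)
    rcases hne.lt_or_gt with h | h
    · exact ⟨-1, by norm_num, by linarith⟩
    · exact ⟨1, by norm_num, by linarith⟩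
  have hW : IsOpen (V ∩ {x | 0 < ε * J x}) :=
    (continuousOn_const.mul cJ).isOpen_inter_preimage hV isOpen_Ioi
  have cr : ∀ x ∈ V ∩ {x | 0 < ε * J x},
      fderiv ℝ q x (0, 1) = ε * fderiv ℝ p x (1, 0) ∧
      fderiv ℝ q x (1, 0) = -ε * fderiv ℝ p x (0, 1) := by
    rintro x ⟨hx, hxp⟩
    obtain ⟨h1, h2, h3⟩ := rel x hx
    have h4 : ε * J x = m x := by
      have h5 : (ε * J x) ^ 2 = m x ^ 2 := by rw [mul_pow, hε, h3, one_mul]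
      exact (pow_left_inj₀ (le_of_lt hxp) (hm x hx).le two_ne_zero).1 h5
    -- Conformality with εJ = m makes this sum of squares equal to 2m - 2εJ = 0, which gives the
    -- Cauchy-Riemann equations up to the sign ε.
    have h5 : (fderiv ℝ q x (0, 1) - ε * fderiv ℝ p x (1, 0)) ^ 2
        + (fderiv ℝ q x (1, 0) + ε * fderiv ℝ p x (0, 1)) ^ 2 = 0 := by
      simp only [hJ] at h4
      linear_combination h1 + h2 - 2 * h4
        + (fderiv ℝ p x (1, 0) ^ 2 + fderiv ℝ p x (0, 1) ^ 2) * hε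
    have h6 := pow_eq_zero_iff two_ne_zero |>.1
      (le_antisymm (by nlinarith [sq_nonneg (fderiv ℝ q x (1, 0) + ε * fderiv ℝ p x (0, 1))])
        (sq_nonneg (fderiv ℝ q x (0, 1) - ε * fderiv ℝ p x (1, 0))))
    rw [h6] at h5
    have h7 := pow_eq_zero_iff two_ne_zero |>.1 (show
      (fderiv ℝ q x (1, 0) + ε * fderiv ℝ p x (0, 1)) ^ 2 = 0 by linarith)
    exact ⟨by linarith, by linarith⟩
  refine ⟨_, Set.inter_subset_left, hW, ⟨hx₀, hpos⟩, fun x hx => ⟨?_, ?_⟩⟩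
  · obtain ⟨h1, h2⟩ := cr x hx
    have h3 := (rel x hx.1).1
    rw [h2] at h3
    linear_combination h3 - fderiv ℝ p x (0, 1) ^ 2 * hε
  · have hP := fun w => hasFDerivAt_of_contDiffOn hV (sP w) hx.1
    have hQ := fun w => hasFDerivAt_of_contDiffOn hV (sQ w) hx.1
    have e1 := (hQ (0, 1)).apply_eq_of_eqOn ((hP (1, 0)).const_mul ε) hW hx
      (fun y hy => (cr y hy).1) (1, 0)
    have e2 := (hQ (1, 0)).apply_eq_of_eqOn ((hP (0, 1)).const_mul (-ε)) hW hx
      (fun y hy => (cr y hy).2) (0, 1)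
    -- Harmonicity of p is the symmetry of the second derivatives of q.
    have e3 := fderiv_fderiv_apply_comm
      ((hq.contDiffAt (hV.mem_nhds hx.1)).of_le two_le_infty) (0, 1) (1, 0)
    simp only [smul_apply, smul_eq_mul] at e1 e2
    rw [e1, e2] at e3
    linear_combination ε * e3 - (fderiv ℝ (fun x => fderiv ℝ p x (1, 0)) x (1, 0)
        + fderiv ℝ (fun x => fderiv ℝ p x (0, 1)) x (0, 1)) * hε

namespace EllipticTriple

variable {a b a' b' : ℝ} {S C D S' C' D' : ℝ → ℝ}

theorem hasDerivAt_add (h : EllipticTriple a b S C D) (u : ℝ) :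
    HasDerivAt (fun u => C u + D u) (-(S u * (C u + D u))) u :=
  ((h.deriv_C u).fun_add (h.deriv_D u)).congr_deriv (by ring)

theorem hasFDerivAt_add_comp (h : EllipticTriple a b S C D) {f : ℝ × ℝ → ℝ}
    {f' : ℝ × ℝ →L[ℝ] ℝ} {x : ℝ × ℝ} (hf : HasFDerivAt f f' x) :
    HasFDerivAt (fun x => C (f x) + D (f x)) ((-(S (f x) * (C (f x) + D (f x)))) • f') x :=
  (h.hasDerivAt_add (f x)).comp_hasFDerivAt x hf

theorem hasFDerivAt_S_comp (h : EllipticTriple a b S C D) {f : ℝ × ℝ → ℝ}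
    {f' : ℝ × ℝ →L[ℝ] ℝ} {x : ℝ × ℝ} (hf : HasFDerivAt f f' x) :
    HasFDerivAt (fun x => S (f x)) ((C (f x) * D (f x)) • f') x :=
  (h.deriv_S (f x)).comp_hasFDerivAt x hf

/-- Invariance of the Gauss curvature under local isometries. -/
theorem curvature_eq (h : EllipticTriple a b S C D) (h' : EllipticTriple a' b' S' C' D')
    {V : Set (ℝ × ℝ)} (hV : IsOpen V) {p : ℝ × ℝ → ℝ} (hp : ContDiffOn ℝ ∞ p V)
    (hm : ∀ x ∈ V, (C' (p x) + D' (p x)) ^ 2 *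
      (fderiv ℝ p x (1, 0) ^ 2 + fderiv ℝ p x (0, 1) ^ 2) = (C x.1 + D x.1) ^ 2)
    (hh : ∀ x ∈ V, fderiv ℝ (fun x => fderiv ℝ p x (1, 0)) x (1, 0)
        + fderiv ℝ (fun x => fderiv ℝ p x (0, 1)) x (0, 1) = 0) {x : ℝ × ℝ} (hx : x ∈ V) :
    C x.1 * D x.1 =
      C' (p x) * D' (p x) * (fderiv ℝ p x (1, 0) ^ 2 + fderiv ℝ p x (0, 1) ^ 2) := by
  have cp : ∀ x ∈ V, ContDiffAt ℝ 2 p x := fun x hx =>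
    (hp.contDiffAt (hV.mem_nhds hx)).of_le two_le_infty
  have sP := contDiffOn_fderiv_apply hV hp
  have sym := fun x hx => fderiv_fderiv_apply_comm (cp x hx) (0, 1) (1, 0)
  set P₁ : ℝ × ℝ → ℝ := fun x => fderiv ℝ p x (1, 0) with hP₁
  set P₂ : ℝ × ℝ → ℝ := fun x => fderiv ℝ p x (0, 1) with hP₂
  have s₁ : ContDiffOn ℝ ∞ P₁ V := sP _
  have s₂ : ContDiffOn ℝ ∞ P₂ V := sP _
  have pos : ∀ x ∈ V, 0 < P₁ x ^ 2 + P₂ x ^ 2 := fun x hx =>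
    pos_of_mul_pos_right (by rw [hm x hx]; exact pow_pos (h.pos _) 2) (sq_nonneg _)
  have dp := fun x hx => hasFDerivAt_of_contDiffOn (x := x) hV hp hx
  have d₁ := fun x hx => hasFDerivAt_of_contDiffOn (x := x) hV s₁ hx
  have d₂ := fun x hx => hasFDerivAt_of_contDiffOn (x := x) hV s₂ hx
  -- Half the derivative of the conformality relation `hm`, with (C + D)' = -S(C + D) and the factor
  -- (C' + D')² cancelled.
  have first : ∀ x ∈ V, ∀ w : ℝ × ℝ,
      P₁ x * fderiv ℝ P₁ x w + P₂ x * fderiv ℝ P₂ x w =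
        (P₁ x ^ 2 + P₂ x ^ 2) * (S' (p x) * fderiv ℝ p x w - S x.1 * w.1) := by
    intro x hx w
    have e := (((h'.hasFDerivAt_add_comp (dp x hx)).pow 2).fun_mul
      (((d₁ x hx).pow 2).fun_add ((d₂ x hx).pow 2))).apply_eq_of_eqOn
      ((h.hasFDerivAt_add_comp hasFDerivAt_fst).pow 2) hV hx hm w
    simp at e
    have hx' := hm x hx
    rw [show fderiv ℝ p x (1, 0) = P₁ x from rfl, show fderiv ℝ p x (0, 1) = P₂ x from rfl] at hx'
    have hr := (pow_pos (h'.pos (p x)) 2).ne'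
    refine mul_left_cancel₀ hr ?_
    linear_combination e / 2 + S x.1 * w.1 * hx'
  -- For harmonic p the function f = P₁ - iP₂ is holomorphic; `α` and `β` are the real and imaginary
  -- parts of f' = S'(p)f² - S(u)f.
  have α : ∀ x ∈ V, fderiv ℝ P₁ x (1, 0) =
      S' (p x) * (P₁ x ^ 2 - P₂ x ^ 2) - S x.1 * P₁ x := by
    intro x hx
    have e₁ := first x hx (1, 0)
    have e₂ := first x hx (0, 1)
    have e₃ := hh x hx
    have e₄ := sym x hx
    rw [show fderiv ℝ p x (1, 0) = P₁ x from rfl] at e₁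
    rw [show fderiv ℝ p x (0, 1) = P₂ x from rfl] at e₂
    refine mul_left_cancel₀ (pos x hx).ne' ?_
    linear_combination P₁ x * e₁ - P₂ x * e₂ + P₂ x ^ 2 * e₃ - P₁ x * P₂ x * e₄
  have β : ∀ x ∈ V, fderiv ℝ P₁ x (0, 1) =
      2 * (S' (p x) * (P₁ x * P₂ x)) - S x.1 * P₂ x := by
    intro x hx
    have e₁ := first x hx (1, 0)
    have e₂ := first x hx (0, 1)
    have e₃ := hh x hx
    have e₄ := sym x hx
    rw [show fderiv ℝ p x (1, 0) = P₁ x from rfl] at e₁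
    rw [show fderiv ℝ p x (0, 1) = P₂ x from rfl] at e₂
    refine mul_left_cancel₀ (pos x hx).ne' ?_
    linear_combination P₂ x * e₁ + P₁ x * e₂ - P₁ x * P₂ x * e₃ - P₂ x ^ 2 * e₄
  have dA := fun w => hasFDerivAt_of_contDiffOn hV (contDiffOn_fderiv_apply hV s₁ w) hx
  have dS := h.hasFDerivAt_S_comp (hasFDerivAt_fst (𝕜 := ℝ) (p := x))
  have dS' := h'.hasFDerivAt_S_comp (dp x hx)
  have hA := (dA (1, 0)).apply_eq_of_eqOn
    ((dS'.fun_mul (((d₁ x hx).pow 2).fun_sub ((d₂ x hx).pow 2))).fun_sub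
      (dS.fun_mul (d₁ x hx))) hV hx α
  have hB := (dA (0, 1)).apply_eq_of_eqOn
    (((dS'.fun_mul ((d₁ x hx).fun_mul (d₂ x hx))).const_mul 2).fun_sub
      (dS.fun_mul (d₂ x hx))) hV hx β
  have hA₁ := hA (1, 0)
  have hA₂ := hA (0, 1)
  have hB₁ := hB (1, 0)
  have hB₂ := hB (0, 1)
  have symA := fderiv_fderiv_apply_comm
    ((s₁.contDiffAt (hV.mem_nhds hx)).of_le two_le_infty) (1, 0) (0, 1)
  -- `harm` and `symA` say that f' is again holomorphic.
  have harm : fderiv ℝ (fun x => fderiv ℝ P₁ x (1, 0)) x (1, 0) =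
      -fderiv ℝ (fun x => fderiv ℝ P₁ x (0, 1)) x (0, 1) := by
    have dC := fun w => hasFDerivAt_of_contDiffOn hV (contDiffOn_fderiv_apply hV s₂ w) hx
    have f₁ := (dA (1, 0)).apply_eq_of_eqOn (dC (0, 1)).fun_neg hV hx
      (fun y hy => eq_neg_of_add_eq_zero_left (hh y hy)) (1, 0)
    have f₂ := (dC (1, 0)).apply_eq_of_eqOn (dA (0, 1)) hV hx (fun y hy => sym y hy) (0, 1)
    rw [f₁, ← f₂, neg_apply, fderiv_fderiv_apply_comm
      ((s₂.contDiffAt (hV.mem_nhds hx)).of_le two_le_infty) (0, 1) (1, 0)]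
  have e₃ := hh x hx
  have e₄ := sym x hx
  simp at hA₁ hA₂ hB₁ hB₂
  rw [show fderiv ℝ p x (1, 0) = P₁ x from rfl] at hA₁ hB₁
  rw [show fderiv ℝ p x (0, 1) = P₂ x from rfl] at hA₂ hB₂
  refine mul_left_cancel₀ (pos x hx).ne' ?_
  rw [show fderiv ℝ p x (1, 0) = P₁ x from rfl, show fderiv ℝ p x (0, 1) = P₂ x from rfl]
  -- Applying ∂̄ to S'(p)f² - S(u)f must give 0, so C'D'|f|²f = CDf. The combination of both
  -- components with weights P₁ and P₂ is the claim multiplied by |f|².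
  linear_combination P₁ x * (hA₁ + hB₂ - harm + 2 * S' (p x) * P₁ x * e₃
      - 2 * S' (p x) * P₂ x * e₄ - S x.1 * e₃)
    + P₂ x * (symA - hA₂ + hB₁ + 2 * S' (p x) * P₁ x * e₄ + 2 * S' (p x) * P₂ x * e₃
      - S x.1 * e₄)

/-- Isometric pieces of two helicoids of constant mean curvature have the same modulus. -/
theorem modulus_eq (h : EllipticTriple a b S C D) (h' : EllipticTriple a' b' S' C' D')
    (hab : a ^ 2 ≤ b ^ 2) (hab' : a' ^ 2 ≤ b' ^ 2)
    {V : Set (ℝ × ℝ)} (hV : IsOpen V) {x : ℝ × ℝ} (hx : x ∈ V) {p q : ℝ × ℝ → ℝ}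
    (hp : ContDiffOn ℝ ∞ p V) (hq : ContDiffOn ℝ ∞ q V)
    (hm : ∀ x ∈ V, ∀ w : ℝ × ℝ, (C' (p x) + D' (p x)) ^ 2 *
      (fderiv ℝ p x w ^ 2 + fderiv ℝ q x w ^ 2) = (C x.1 + D x.1) ^ 2 * (w.1 ^ 2 + w.2 ^ 2)) :
    (b ^ 2 - a ^ 2) * a' ^ 2 = (b' ^ 2 - a' ^ 2) * a ^ 2 := by
  have hρ' : ∀ x : ℝ × ℝ, 0 < (C' (p x) + D' (p x)) ^ 2 := fun x => pow_pos (h'.pos _) 2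
  have hρ : ∀ x : ℝ × ℝ, 0 < (C x.1 + D x.1) ^ 2 := fun x => pow_pos (h.pos _) 2
  obtain ⟨W, hWV, hW, hxW, key⟩ := exists_harmonic_of_conformal hV hx hp hq
    (m := fun x => (C x.1 + D x.1) ^ 2 / (C' (p x) + D' (p x)) ^ 2)
    (fun x _ => div_pos (hρ x) (hρ' x))
    (fun x hx w => by
      rw [div_mul_eq_mul_div, eq_div_iff (hρ' x).ne', ← hm x hx w, mul_comm])
  have hpW := hp.mono hWV
  have hmW : ∀ x ∈ W, (C' (p x) + D' (p x)) ^ 2 *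
      (fderiv ℝ p x (1, 0) ^ 2 + fderiv ℝ p x (0, 1) ^ 2) = (C x.1 + D x.1) ^ 2 := fun x hx => by
    rw [(key x hx).1, mul_div_cancel₀ _ (hρ' x).ne']
  have hcurv : ∀ x ∈ W, (b ^ 2 - a ^ 2) * (C' (p x) + D' (p x)) ^ 2 =
      (b' ^ 2 - a' ^ 2) * (C x.1 + D x.1) ^ 2 := by
    intro x hx
    have e := h.curvature_eq h' hW hpW hmW (fun y hy => (key y hy).2) hx
    have e₂ : C x.1 * D x.1 * (C' (p x) + D' (p x)) ^ 2 =
        C' (p x) * D' (p x) * (C x.1 + D x.1) ^ 2 := by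
      linear_combination (C' (p x) + D' (p x)) ^ 2 * e + C' (p x) * D' (p x) * hmW x hx
    -- Both sides are nonnegative, so squares may be compared; δ² = T(T - 4CD) with T = (C + D)²
    -- reduces them to the curvature identity `e₂`.
    rw [← pow_left_inj₀ (mul_nonneg (sub_nonneg.2 hab) (hρ' x).le)
      (mul_nonneg (sub_nonneg.2 hab') (hρ x).le) two_ne_zero,
      show b ^ 2 - a ^ 2 = D x.1 ^ 2 - C x.1 ^ 2 by rw [h.C_sq, h.D_sq]; ring,
      show b' ^ 2 - a' ^ 2 = D' (p x) ^ 2 - C' (p x) ^ 2 by rw [h'.C_sq, h'.D_sq]; ring]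
    linear_combination -4 * (C x.1 + D x.1) ^ 2 * (C' (p x) + D' (p x)) ^ 2 * e₂
  have hder := fun w => (((h'.hasFDerivAt_add_comp (hasFDerivAt_of_contDiffOn hW hpW hxW)).pow
    2).const_mul (b ^ 2 - a ^ 2)).apply_eq_of_eqOn
    (((h.hasFDerivAt_add_comp hasFDerivAt_fst).pow 2).const_mul (b' ^ 2 - a' ^ 2)) hW hxW hcurv w
  have h₁ := hder (1, 0)
  have h₂ := hder (0, 1)
  have h₃ := hcurv x hxW
  have h₄ := hmW x hxW
  simp only [smul_apply, smul_eq_mul, ContinuousLinearMap.coe_fst', nsmul_eq_mul, mul_zero,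
    mul_one] at h₁ h₂
  norm_num only [pow_one] at h₁ h₂
  set δ := b ^ 2 - a ^ 2 with hδ
  set δ' := b' ^ 2 - a' ^ 2 with hδ'
  have hT := hρ x
  have hR := hρ' x
  -- If δ = 0, then δ' = 0 as well and both sides of the goal vanish.
  rcases eq_or_ne δ 0 with h0 | h0
  · rw [h0, zero_mul, eq_comm, mul_eq_zero_iff_right hT.ne'] at h₃
    rw [h0, h₃]
    ring
  have eD : δ = D x.1 ^ 2 - C x.1 ^ 2 := by rw [h.C_sq, h.D_sq, hδ]; ring
  have eD' : δ' = D' (p x) ^ 2 - C' (p x) ^ 2 := by rw [h'.C_sq, h'.D_sq, hδ']; ring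
  have eC := h.C_sq x.1
  have eC' := h'.C_sq (p x)
  generalize fderiv ℝ p x (1, 0) = P₁ at *
  generalize fderiv ℝ p x (0, 1) = P₂ at *
  have g₁ : S' (p x) * P₁ = S x.1 := by
    refine mul_left_cancel₀ (mul_ne_zero h0 hR.ne') ?_
    linear_combination -h₁ / 2 - S x.1 * h₃
  have g₂ : S' (p x) * P₂ = 0 := by
    refine mul_left_cancel₀ (mul_ne_zero h0 hR.ne') ?_
    linear_combination -h₂ / 2
  -- Squaring and adding `g₁` and `g₂` gives S'²(P₁² + P₂²) = S², and P₁² + P₂² is the quotient of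
  -- the conformal factors, known from `h₃`.
  have g₃ : δ * S' (p x) ^ 2 = δ' * S x.1 ^ 2 := by
    refine mul_right_cancel₀ hT.ne' ?_
    linear_combination S x.1 ^ 2 * h₃ - δ * S' (p x) ^ 2 * h₄
      + δ * (C' (p x) + D' (p x)) ^ 2 * ((S' (p x) * P₁ + S x.1) * g₁ + S' (p x) * P₂ * g₂)
  have g₄ : δ * C' (p x) ^ 2 = δ' * C x.1 ^ 2 := by
    -- From D² - C² = δ it follows that 2C(C + D) = (C + D)² - δ, so C² is a function of (C + D)²
    -- and δ.
    have k₁ : 4 * C x.1 ^ 2 * (C x.1 + D x.1) ^ 2 = ((C x.1 + D x.1) ^ 2 - δ) ^ 2 := by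
      rw [eD]; ring
    have k₂ : 4 * C' (p x) ^ 2 * (C' (p x) + D' (p x)) ^ 2 =
        ((C' (p x) + D' (p x)) ^ 2 - δ') ^ 2 := by
      rw [eD']; ring
    generalize (C x.1 + D x.1) ^ 2 = T at *
    generalize (C' (p x) + D' (p x)) ^ 2 = R at *
    refine mul_right_cancel₀ (mul_pos hR hT).ne' ?_
    linear_combination δ * T / 4 * k₂ - δ' * R / 4 * k₁ + (R * T - δ * δ') / 4 * h₃
  linear_combination g₃ + g₄ - δ * eC' + δ' * eC

end EllipticTriple

/-! ### Fundamental forms of the helicoids. -/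

section

variable {H a b : ℝ}

theorem neg_one_div_two_mul_ne_zero (hH : H ≠ 0) : -1 / (2 * H) ≠ 0 :=
  div_ne_zero (by norm_num) (mul_ne_zero two_ne_zero hH)

theorem gaussMap_cmcHelicoid (hH : H ≠ 0) (h0 : 0 ≤ a) (h1 : a ≤ 1) (hb : 1 ≤ b) :
    gaussMap (cmcHelicoid H a b) = profileNormal (fun u => a * jacobiSn (b * u) (a / b))
      (helicoidRoot a b) (helicoidG a b) := by
  rw [cmcHelicoid_eq]
  exact (helicoid_profile h0 h1 hb).gaussMap_eq (neg_one_div_two_mul_ne_zero hH)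

theorem firstForm_cmcHelicoid (h0 : 0 ≤ a) (h1 : a ≤ 1) (hb : 1 ≤ b)
    (p w w' : ℝ × ℝ) :
    firstForm (cmcHelicoid H a b) p w w' =
      (a * jacobiCn (b * p.1) (a / b) + b * jacobiDn (b * p.1) (a / b)) ^ 2 / (4 * H ^ 2)
        * (w.1 * w'.1 + w.2 * w'.2) := by
  have hp := helicoid_profile h0 h1 hb
  have ht := helicoid_triple h0 h1 hb
  rw [cmcHelicoid_eq, hp.firstForm_smul, div_pow]
  have e : (helicoidRoot a b p.1 + helicoidK a b p.1) ^ 2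
      + (helicoidC₁ a b / helicoidRoot a b p.1) ^ 2 =
      (a * jacobiCn (b * p.1) (a / b) + b * jacobiDn (b * p.1) (a / b)) ^ 2 := by
    have h2 := hp.K_sq p.1
    rw [helicoidC₂] at h2
    linear_combination h2 + hp.sq_add_sq p.1 - ht.C_sq p.1 - ht.D_sq p.1
      + 2 * helicoidRoot_mul_helicoidK (b := b) h0 h1 p.1
  rw [e]
  ring

theorem meanCurvature_cmcHelicoid (hH : H ≠ 0) (h0 : 0 ≤ a) (h1 : a ≤ 1) (hb : 1 ≤ b)
    (p : ℝ × ℝ) : meanCurvature (cmcHelicoid H a b) p = H := by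
  rw [cmcHelicoid_eq, (helicoid_profile h0 h1 hb).meanCurvature_smul
    (neg_one_div_two_mul_ne_zero hH)]
  field_simp

theorem hopfDifferential_cmcHelicoid (hH : H ≠ 0) (h0 : 0 ≤ a) (h1 : a ≤ 1) (hb : 1 ≤ b)
    (p w : ℝ × ℝ) :
    hopfDifferential (cmcHelicoid H a b) p w =
      ((√(b ^ 2 - 1) : ℂ) - Complex.I * (√(1 - a ^ 2) : ℂ)) ^ 2 / (4 * (H : ℂ))
        * ((w.1 : ℂ) + Complex.I * (w.2 : ℂ)) ^ 2 := by
  rw [cmcHelicoid_eq, (helicoid_profile h0 h1 hb).hopfDifferential_smul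
    (neg_one_div_two_mul_ne_zero hH)]
  have ha' : 0 ≤ 1 - a ^ 2 := by nlinarith
  have hb' : 0 ≤ b ^ 2 - 1 := by nlinarith
  have e₁ : ((√(b ^ 2 - 1) : ℝ) : ℂ) ^ 2 = b ^ 2 - 1 := by
    rw [← Complex.ofReal_pow, Real.sq_sqrt hb']; push_cast; ring
  have e₂ : ((√(1 - a ^ 2) : ℝ) : ℂ) ^ 2 = 1 - a ^ 2 := by
    rw [← Complex.ofReal_pow, Real.sq_sqrt ha']; push_cast; ring
  have hH' : (H : ℂ) ≠ 0 := by exact_mod_cast hH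
  rw [helicoidC₁, Real.sqrt_mul ha', helicoidC₂]
  push_cast
  field_simp
  linear_combination -4 * (w.1 + Complex.I * w.2 : ℂ) ^ 2 * (e₁ - e₂ + (√(1 - a ^ 2) : ℂ) ^ 2 *
    Complex.I_sq)

theorem smul_cmcHelicoid (hH : H ≠ 0) (a b : ℝ) :
    (fun p => (-2 * H) • cmcHelicoid H a b p) = profileSurface (helicoidC₁ a b)
      (fun u => a * jacobiSn (b * u) (a / b)) (helicoidRoot a b) (helicoidK a b)
      (fun u => helicoidC₁ a b / helicoidRoot a b u) (helicoidG a b) (helicoidHeight a b) := by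
  funext p
  rw [cmcHelicoid_eq, smul_smul, show -2 * H * (-1 / (2 * H)) = 1 by field_simp, one_smul]

end

/-! ### Associated families and isometry. -/

theorem exists_exp_mul_of_norm_eq {z z' : ℂ} (h : ‖z'‖ = ‖z‖) :
    ∃ θ : ℝ, z' = Complex.exp (Complex.I * (θ : ℂ)) * z := by
  rcases eq_or_ne z 0 with rfl | hz
  · exact ⟨0, by simpa using h⟩
  · refine ⟨Complex.arg (z' / z), ?_⟩
    have h1 : ‖z' / z‖ = 1 := by rw [norm_div, h, div_self (norm_ne_zero_iff.2 hz)]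
    have h2 := Complex.norm_mul_exp_arg_mul_I (z' / z)
    rw [h1, Complex.ofReal_one, one_mul, mul_comm] at h2
    rw [h2, div_mul_cancel₀ _ hz]

theorem norm_sqrt_sub_I_mul_sqrt_sq {x y : ℝ} (hx : 0 ≤ x) (hy : 0 ≤ y) :
    ‖((√x : ℂ) - Complex.I * (√y : ℂ)) ^ 2‖ = x + y := by
  rw [norm_pow, Complex.sq_norm, Complex.normSq_apply]
  simp [Real.mul_self_sqrt, hx, hy]

/-- The change of parameters is p ↦ tp with t = b/b'. Since a = ta' and b = tb', it preserves the
modulus and the arguments of the elliptic functions, and the metric factor absorbs t². -/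
theorem sameAssociatedFamily_of_div_eq {H a b a' b' : ℝ} (hH : H ≠ 0) (h0 : 0 ≤ a) (h1 : a ≤ 1)
    (hb : 1 ≤ b) (h0' : 0 ≤ a') (h1' : a' ≤ 1) (hb' : 1 ≤ b') (h : a / b = a' / b') :
    SameAssociatedFamily (cmcHelicoid H a b) (cmcHelicoid H a' b') := by
  have pb : 0 < b := by linarith
  have pb' : 0 < b' := by linarith
  have pt : 0 < b / b' := div_pos pb pb'
  set t := b / b' with ht
  have tb : b' * t = b := mul_div_cancel₀ _ pb'.ne'
  have ta : a' * t = a := by rw [ht]; field_simp at h ⊢; linarith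
  -- The coefficients of 4HQ have norms b² - a² and b'² - a'², and b² - a² = t²(b'² - a'²).
  have hnorm : ‖((√(b' ^ 2 - 1) : ℂ) - Complex.I * (√(1 - a' ^ 2) : ℂ)) ^ 2 * (t : ℂ) ^ 2‖ =
      ‖((√(b ^ 2 - 1) : ℂ) - Complex.I * (√(1 - a ^ 2) : ℂ)) ^ 2‖ := by
    rw [norm_mul, norm_sqrt_sub_I_mul_sqrt_sq (by nlinarith) (by nlinarith),
      norm_sqrt_sub_I_mul_sqrt_sq (by nlinarith) (by nlinarith), norm_pow, Complex.norm_real,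
      Real.norm_of_nonneg pt.le, ← ta, ← tb]
    ring
  obtain ⟨θ, hθ⟩ := exists_exp_mul_of_norm_eq hnorm
  have hfd : ∀ p : ℝ × ℝ, fderiv ℝ (fun p : ℝ × ℝ => t • p) p =
      t • ContinuousLinearMap.id ℝ (ℝ × ℝ) := fun p => by
    rw [fderiv_fun_const_smul differentiableAt_fun_id, fderiv_fun_id]
  refine ⟨⟨fun p => t • p, fun p => t⁻¹ • p, fun p => inv_smul_smul₀ pt.ne' p,
    fun p => smul_inv_smul₀ pt.ne' p⟩, θ, contDiff_const_smul t, contDiff_const_smul t⁻¹,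
    fun p => ?_, fun p _ w => ?_, fun p => ?_, fun p w => ?_⟩
  · simp only [Equiv.coe_fn_mk]
    rw [hfd]
    change 0 < LinearMap.det (t • (LinearMap.id : ℝ × ℝ →ₗ[ℝ] ℝ × ℝ))
    rw [LinearMap.det_smul, LinearMap.det_id]
    positivity
  · simp only [Equiv.coe_fn_mk]
    rw [hfd, firstForm_cmcHelicoid h0' h1' hb', firstForm_cmcHelicoid h0 h1 hb]
    simp only [smul_apply, ContinuousLinearMap.id_apply, Prod.smul_fst, Prod.smul_snd,
      smul_eq_mul]
    rw [← mul_assoc b', tb, ← h]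
    generalize jacobiCn (b * p.1) (a / b) = c
    generalize jacobiDn (b * p.1) (a / b) = d
    rw [← ta, ← tb]
    ring
  · rw [meanCurvature_cmcHelicoid hH h0' h1' hb', meanCurvature_cmcHelicoid hH h0 h1 hb]
  · simp only [Equiv.coe_fn_mk]
    rw [hfd, hopfDifferential_cmcHelicoid hH h0' h1' hb', hopfDifferential_cmcHelicoid hH h0 h1 hb]
    simp only [smul_apply, ContinuousLinearMap.id_apply, Prod.smul_fst, Prod.smul_snd,
      smul_eq_mul]
    push_cast
    linear_combination ((w.1 + Complex.I * w.2 : ℂ) ^ 2 / (4 * H)) * hθ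

theorem div_eq_of_locallyIsometric {H a b a' b' : ℝ} (hH : H ≠ 0) (h0 : 0 ≤ a) (h1 : a ≤ 1)
    (hb : 1 ≤ b) (h0' : 0 ≤ a') (h1' : a' ≤ 1) (hb' : 1 ≤ b')
    (h : LocallyIsometricSurfaces (cmcHelicoid H a b) (cmcHelicoid H a' b')) :
    a / b = a' / b' := by
  obtain ⟨U, φ, hU, ⟨x, hx⟩, hφ, hpb⟩ := h
  have key := (helicoid_triple h0 h1 hb).modulus_eq (helicoid_triple h0' h1' hb')
    (by nlinarith) (by nlinarith) hU hx (p := fun x => (φ x).1) (q := fun x => (φ x).2)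
    hφ.fst hφ.snd fun y hy w => by
      have hd : HasFDerivAt φ (fderiv ℝ φ y) y :=
        ((hφ.contDiffAt (hU.mem_nhds hy)).differentiableAt (by simp)).hasFDerivAt
      have e := hpb y hy w
      rw [firstForm_cmcHelicoid h0' h1' hb', firstForm_cmcHelicoid h0 h1 hb] at e
      rw [hd.fst.fderiv, hd.snd.fderiv]
      simp only [ContinuousLinearMap.comp_apply, ContinuousLinearMap.coe_fst',
        ContinuousLinearMap.coe_snd']
      field_simp at e
      linear_combination e
  -- The terms a²a'² on the two sides of `key` cancel.
  have e : (a * b') ^ 2 = (a' * b) ^ 2 := by linear_combination -key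
  have pb : b ≠ 0 := by linarith
  have pb' : b' ≠ 0 := by linarith
  rw [div_eq_div_iff pb pb']
  exact (pow_left_inj₀ (by positivity) (by positivity) two_ne_zero).1 e

theorem proposition5p10 :
    (∀ H a b : ℝ, H ≠ 0 → 0 ≤ a → a ≤ 1 → 1 ≤ b →
      ContDiff ℝ ∞ (cmcHelicoid H a b) ∧
      ContDiff ℝ ∞ (gaussMap (cmcHelicoid H a b)) ∧
      ContDiff ℝ ∞ (cgcCompanion (fun p => (-2 * H) • cmcHelicoid H a b p)) ∧
      (∀ p : ℝ × ℝ, meanCurvature (cmcHelicoid H a b) p = H) ∧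
      ∀ u v du dv : ℝ,
        let x : ParamSurface := cmcHelicoid H a b
        let n : ParamSurface := gaussMap x
        let y : ParamSurface := cgcCompanion (fun p => (-2 * H) • x p)
        let p : ℝ × ℝ := (u, v)
        let w : ℝ × ℝ := (du, dv)
        let sn : ℝ := jacobiSn (b * u) (a / b)
        let cn : ℝ := jacobiCn (b * u) (a / b)
        let dn : ℝ := jacobiDn (b * u) (a / b)
        let c₁ : ℝ := helicoidC₁ a b
        let c₂ : ℝ := helicoidC₂ a b
        4 * H ^ 2 * firstForm x p w w = (a * cn + b * dn) ^ 2 * (du ^ 2 + dv ^ 2) ∧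
        4 * H * (secondForm x n p w w - H * firstForm x p w w) =
          (c₂ - 1) * (du ^ 2 - dv ^ 2) + 4 * c₁ * du * dv ∧
        thirdForm n p w w =
          (c₂ - a ^ 2 * sn ^ 2) * du ^ 2 + 2 * c₁ * du * dv + (1 - a ^ 2 * sn ^ 2) * dv ^ 2 ∧
        hopfDifferential x p w =
          ((√(b ^ 2 - 1) : ℂ) - Complex.I * (√(1 - a ^ 2) : ℂ)) ^ 2 / (4 * (H : ℂ))
            * ((du : ℂ) + Complex.I * (dv : ℂ)) ^ 2 ∧
        firstForm y p w w =
          (1 - a ^ 2 * sn ^ 2) * du ^ 2 - 2 * c₁ * du * dv + (c₂ - a ^ 2 * sn ^ 2) * dv ^ 2 ∧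
        secondForm y n p w w = -(a * b * cn * dn) * (du ^ 2 + dv ^ 2)) ∧
    (∀ H a b a' b' : ℝ, H ≠ 0 → 0 ≤ a → a ≤ 1 → 1 ≤ b → 0 ≤ a' → a' ≤ 1 → 1 ≤ b' →
      List.TFAE
        [a / b = a' / b',
         SameAssociatedFamily (cmcHelicoid H a b) (cmcHelicoid H a' b'),
         IsometricSurfaces (cmcHelicoid H a b) (cmcHelicoid H a' b'),
         LocallyIsometricSurfaces (cmcHelicoid H a b) (cmcHelicoid H a' b')]) := by
  refine ⟨fun H a b hH h0 h1 hb => ?_, fun H a b a' b' hH h0 h1 hb h0' h1' hb' => ?_⟩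
  · have hp := helicoid_profile h0 h1 hb
    have hn := gaussMap_cmcHelicoid hH h0 h1 hb
    have hy := smul_cmcHelicoid hH a b
    refine ⟨?_, ?_, ?_, meanCurvature_cmcHelicoid hH h0 h1 hb, ?_⟩
    · rw [cmcHelicoid_eq]
      exact hp.contDiff_surface.const_smul _
    · rw [hn]
      exact hp.contDiff_normal
    · rw [hy, hp.cgcCompanion_eq]
      exact hp.contDiff_surface.sub hp.contDiff_normal
    · intro u v du dv
      dsimp only
      rw [hn, hy, hp.cgcCompanion_eq, firstForm_cmcHelicoid h0 h1 hb, hp.thirdForm_normal,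
        hopfDifferential_cmcHelicoid hH h0 h1 hb, hp.firstForm_companion,
        hp.secondForm_companion, helicoidRoot_mul_helicoidK h0 h1]
      refine ⟨?_, ?_, by ring, rfl, by ring, by ring⟩
      · field_simp
      · rw [← firstForm_cmcHelicoid h0 h1 hb (u, v) (du, dv) (du, dv), cmcHelicoid_eq,
          hp.secondForm_smul, hp.firstForm_smul]
        have e₁ := hp.K_sq u
        have e₂ := hp.B_mul u
        have e₃ := hp.sq_add_sq u
        dsimp only at e₁ e₂ e₃ ⊢
        generalize helicoidC₁ a b / helicoidRoot a b u = B at *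
        rw [← e₂]
        field_simp
        linear_combination 4 * (du ^ 2 - dv ^ 2) * (e₁ - e₃)
  · tfae_have 1 → 2 := sameAssociatedFamily_of_div_eq hH h0 h1 hb h0' h1' hb'
    tfae_have 2 → 3 := fun ⟨φ, _, h, h', _, hφ, _⟩ => ⟨φ, h, h', hφ⟩
    tfae_have 3 → 4 := fun ⟨φ, h, _, hφ⟩ =>
      ⟨Set.univ, φ, isOpen_univ, Set.univ_nonempty, h.contDiffOn, hφ⟩
    tfae_have 4 → 1 := div_eq_of_locallyIsometric hH h0 h1 hb h0' h1' hb'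
    tfae_finish
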